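/- **Setting.** Let $G$ be a connected compact Lie group, $\mathcal H_A=\mathbb C^{d_A}$ with $d_A\ge 2$, and $U_A$ a smooth unitary representation of $G$ on $\mathcal H_A$. Let $J_A^1,\dots,J_A^n$ be traceless Hermitian infinitesimal generators of $U_A$: there are $x_1,\dots,x_n$ spanning the Lie algebra of $G$ with $dU_A(x_k)=iJ_A^k$. Suppose that the representation $X\mapsto U_A(g)XU_A(g)^\dagger$ of $G$ on $\mathcal B(\mathcal H_A)$ decomposes without multiplicity, $\mathcal B(\mathcal H_A)=\bigoplus_{\lambda\in\Lambda}V^\lambda$ with $V^\lambda$ irreducible and pairwise inequivalent; write $\lambda=0$ for the trivial irrep. **Definitions.** A channel is a completely positive trace-preserving linear map $\mathcal E:\mathcal B(\mathcal H_A)\to\mathcal B(\mathcal H_A)$; it is $G$-covariant if $\mathcal E(U_A(g)XU_A(g)^\dagger)=U_A(g)\mathcal E(X)U_A(g)^\dagger$ for all $g\in G$ and all $X$. Its adjoint $\mathcal E^\dagger$ is defined by $\mathrm{tr}(\mathcal E(X)Y)=\mathrm{tr}(X\mathcal E^\dagger(Y))$. The Jamiołkowski operator of a linear map $\mathcal E$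 is $\mathcal J(\mathcal E)=(\mathcal E\otimes\mathcal I)(|\Omega\rangle\langle\Omega|)$ with $|\Omega\rangle=d_A^{-1/2}\sum_j|jj\rangle$. For $\lambda\in\Lambda$, the isolated extremal channel $\mathcal E^\lambda$ is the map with $\mathcal J(\mathcal E^\lambda)=\mathbb 1^\lambda/\dim V^\lambda$, where $\mathbb 1^\lambda$ is the orthogonal projector of $\mathcal H_A\otimes\mathcal H_A$ onto the image of $V^\lambda$ under $|i\rangle\langle j|\mapsto|i\rangle\otimes|j\rangle$. With $d\psi$ the Haar probability measure on pure states $\psi=|\psi\rangle\langle\psi|$, put $$\Delta(\mathcal E)=\sum_{k=1}^n\int\bigl|\mathrm{tr}\bigl(\mathcal E(\psi)J_A^k-\psi J_A^k\bigr)\bigr|^2d\psi,\qquad u(\mathcal E)=\frac{d_A}{d_A-1}\int\mathrm{tr}\Bigl(\mathcal E\bigl(\psi-\tfrac{\mathbb 1}{d_A}\bigr)^2\Bigr)d\psi,\qquad \|\boldsymbol J_A\|=\Bigl(\sum_{k=1}^n\mathrm{tr}\bigl((J_A^k)^2\bigr)\Bigr)^{1/2}.$$ **Theorem.** (i) Let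 $f(\lambda)$, $\lambda\in\Lambda$, be real coefficients with $\mathcal E^{\lambda\dagger}(J_A^k)=f(\lambda)J_A^k$ for all $\lambda\in\Lambda$ and $k=1,\dots,n$, and let $K=\min_{\lambda\ne0}|1-f(\lambda)|$. Then every $G$-covariant channel $\mathcal E$ on $A$ satisfies $$\sqrt{\Delta(\mathcal E)}\;\ge\;K\,\|\boldsymbol J_A\|\,(1-u(\mathcal E))\,\frac{(d_A-1)(d_A+1)^{1/2}}{2d_A^{5/2}}.$$ (ii) Such coefficients $f(\lambda)$ exist whenever all the generators $J_A^k$ lie in a single irreducible component of $\mathcal B(\mathcal H_A)$ (for instance, when the Lie algebra of $G$ is simple). -/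

import Mathlib

open scoped Manifold ContDiff ComplexOrder

noncomputable section

namespace CovariantChannel

/-- Operators `B(H_A)` on the `d`-dimensional Hilbert space `H_A = ℂ^d`, as matrices. -/
abbrev Op (d : ℕ) := Matrix (Fin d) (Fin d) ℂ

/-- Linear superoperators on `B(H_A)`. -/
abbrev SuperOp (d : ℕ) := Op d →ₗ[ℂ] Op d

/-! ### Quantum channels -/

/-- The extension `id_k ⊗ E` of a superoperator, acting on operators on `ℂ^k ⊗ ℂ^d`. -/
def ampliation {d : ℕ} (E : SuperOp d) (k : ℕ)
    (ρ : Matrix (Fin k × Fin d) (Fin k × Fin d) ℂ) :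
    Matrix (Fin k × Fin d) (Fin k × Fin d) ℂ :=
  Matrix.of fun p q => E (Matrix.of fun i j => ρ (p.1, i) (q.1, j)) p.2 q.2

/-- A quantum channel: a completely positive trace-preserving superoperator. -/
structure IsChannel {d : ℕ} (E : SuperOp d) : Prop where
  completelyPositive : ∀ (k : ℕ) (ρ : Matrix (Fin k × Fin d) (Fin k × Fin d) ℂ),
    ρ.PosSemidef → (ampliation E k ρ).PosSemidef
  tracePreserving : ∀ X : Op d, (E X).trace = X.trace

/-- The adjoint (Heisenberg picture) `E†`, determined by `tr(E(X) Y) = tr(X E†(Y))`. -/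
def adjoint {d : ℕ} (E : SuperOp d) : SuperOp d where
  toFun Y := Matrix.of fun i j => (E (Matrix.single j i 1) * Y).trace
  map_add' Y Z := by
    ext i j
    simp [Matrix.mul_add]
  map_smul' c Y := by
    ext i j
    simp

/-- The defining property of the adjoint. -/
theorem trace_mul_adjoint {d : ℕ} (E : SuperOp d) (X Y : Op d) :
    (E X * Y).trace = (X * adjoint E Y).trace := by
  have key : ∀ i j : Fin d, ∀ c : ℂ,
      (E (Matrix.single i j c) * Y).trace = (Matrix.single i j c * adjoint E Y).trace := by
    intro i j c
    have hc : Matrix.single i j c = c • Matrix.single i j (1 : ℂ) := by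
      simp [Matrix.smul_single]
    rw [Matrix.trace_single_mul, hc, map_smul, Matrix.smul_mul, Matrix.trace_smul]
    simp [adjoint]
  rw [Matrix.matrix_eq_sum_single X]
  simp only [map_sum, Finset.sum_mul, Matrix.trace_sum, key]

/-- The Jamiołkowski operator `(E ⊗ id)(|Ω⟩⟨Ω|)`, `|Ω⟩ = d^{-1/2} ∑ j, |jj⟩`, whose entry at
`((b, a), (b', a'))` is `d⁻¹ ⟨b| E(|a⟩⟨a'|) |b'⟩`. -/
def jamiolkowski {d : ℕ} (E : SuperOp d) : Matrix (Fin d × Fin d) (Fin d × Fin d) ℂ :=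
  Matrix.of fun p q => (d : ℂ)⁻¹ * E (Matrix.single p.2 q.2 1) p.1 q.1

/-- The superoperator with a given Jamiołkowski operator. -/
def ofJamiolkowski {d : ℕ} (J : Matrix (Fin d × Fin d) (Fin d × Fin d) ℂ) : SuperOp d where
  toFun X := Matrix.of fun b b' => (d : ℂ) * ∑ a, ∑ a', X a a' * J (b, a) (b', a')
  map_add' X Y := by
    ext b b'
    simp [add_mul, Finset.sum_add_distrib, mul_add]
  map_smul' c X := by
    ext b b'
    simp only [Matrix.of_apply, Matrix.smul_apply, smul_eq_mul, RingHom.id_apply, mul_assoc,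
      ← Finset.mul_sum]
    ring

theorem jamiolkowski_ofJamiolkowski {d : ℕ}
    (J : Matrix (Fin d × Fin d) (Fin d × Fin d) ℂ) :
    jamiolkowski (ofJamiolkowski J) = J := by
  ext ⟨b, a⟩ ⟨b', a'⟩
  have hd : (d : ℂ) ≠ 0 := by
    have : NeZero d := ⟨fun h => by subst h; exact a.elim0⟩
    exact_mod_cast this.ne
  have hs : ∑ x, ∑ y, (Matrix.single a a' (1 : ℂ)) x y * J (b, x) (b', y) = J (b, a) (b', a') := by
    rw [Finset.sum_eq_single a, Finset.sum_eq_single a']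
    · simp
    · intro y _ hy
      simp [hy.symm]
    · simp
    · intro x _ hx
      simp [hx.symm]
    · simp
  simp [jamiolkowski, ofJamiolkowski, hs, hd]

/-! ### Unitarity and the average total deviation -/

/-- The unitarily invariant (Haar) probability measure on unit vectors of `ℂ^d`: the surface
measure of the unit sphere, normalised to total mass one. -/
def haarState (d : ℕ) :
    MeasureTheory.Measure (Metric.sphere (0 : EuclideanSpace ℂ (Fin d)) 1) :=
  ((MeasureTheory.volume : MeasureTheory.Measure (EuclideanSpace ℂ (Fin d))).toSphere
      Set.univ)⁻¹ •
    (MeasureTheory.volume : MeasureTheory.Measure (EuclideanSpace ℂ (Fin d))).toSphere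

/-- The rank-one projector `|ψ⟩⟨ψ|` of a unit vector. -/
def pureState {d : ℕ} (ψ : Metric.sphere (0 : EuclideanSpace ℂ (Fin d)) 1) : Op d :=
  Matrix.of fun i j => ψ.1 i * star (ψ.1 j)

/-- Unitarity `u(E) = d/(d-1) ∫ tr( E(ψ - 1/d)² ) dψ`. -/
def unitarity {d : ℕ} (E : SuperOp d) : ℝ :=
  (d : ℝ) / ((d : ℝ) - 1) *
    ∫ ψ, ((E (pureState ψ - (d : ℂ)⁻¹ • (1 : Op d))) ^ 2).trace.re ∂(haarState d)

/-- Average total deviation `Δ(E) = ∑ k, ∫ |tr( E(ψ) J^k - ψ J^k )|² dψ`. -/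
def avgDeviation {d n : ℕ} (J : Fin n → Op d) (E : SuperOp d) : ℝ :=
  ∑ k, ∫ ψ, ‖(E (pureState ψ) * J k - pureState ψ * J k).trace‖ ^ 2 ∂(haarState d)

/-- `‖J‖ = ( ∑ k, tr((J^k)²) )^{1/2}`. -/
def genNorm {d n : ℕ} (J : Fin n → Op d) : ℝ :=
  Real.sqrt (∑ k, ((J k) ^ 2).trace.re)

/-! ### Symmetry -/

section Symmetry

variable {G : Type*} [Group G] {d : ℕ}

/-- The representation `X ↦ U(g) X U(g)†` of `G` on `B(H_A)`; under `|i⟩⟨j| ↦ |i⟩ ⊗ |j⟩` it is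
`U ⊗ U*`. -/
def conjRep (U : G →* Matrix.unitaryGroup (Fin d) ℂ) : Representation ℂ G (Op d) where
  toFun g :=
    { toFun := fun X => (U g : Op d) * X * (U g : Op d).conjTranspose
      map_add' := fun X Y => by rw [mul_add, add_mul]
      map_smul' := fun c X => by simp }
  map_one' := by
    ext1 X
    simp
  map_mul' g h := by
    ext1 X
    simp [mul_assoc]

/-- `G`-covariance of a superoperator. -/
def IsCovariant (U : G →* Matrix.unitaryGroup (Fin d) ℂ) (E : SuperOp d) : Prop :=
  ∀ (g : G) (X : Op d), E (conjRep U g X) = conjRep U g (E X)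

/-- `V` is a decomposition of `B(H_A)` into irreducible representations which are pairwise
inequivalent, that is, each of multiplicity one. -/
structure IsMultiplicityFreeDecomposition (U : G →* Matrix.unitaryGroup (Fin d) ℂ)
    {ι : Type*} [DecidableEq ι] (V : ι → Subrepresentation (conjRep U)) :
    Prop where
  isInternal : DirectSum.IsInternal fun l => (V l).toSubmodule
  irreducible : ∀ l, (V l).toRepresentation.IsIrreducible
  inequivalent : ∀ l m, l ≠ m →
    IsEmpty ((V l).toRepresentation.Equiv (V m).toRepresentation)

/-- Vectorisation `∑ X i j |i⟩⟨j| ↦ ∑ X i j |i⟩ ⊗ |j⟩`, from `B(H_A)` to `H_A ⊗ H_A`. -/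
def vectorise (d : ℕ) : Op d →ₗ[ℂ] EuclideanSpace ℂ (Fin d × Fin d) where
  toFun X := WithLp.toLp 2 fun p => X p.1 p.2
  map_add' X Y := by
    ext p
    simp
  map_smul' c X := by
    ext p
    simp

/-- The matrix of the orthogonal projection of `H_A ⊗ H_A` onto the vectorisation of a subspace
of `B(H_A)`. -/
def blockProjection (W : Submodule ℂ (Op d)) : Matrix (Fin d × Fin d) (Fin d × Fin d) ℂ :=
  Matrix.of fun p q =>
    (W.map (vectorise d)).starProjection (EuclideanSpace.single q (1 : ℂ)) p

/-- The channel `E^W` with Jamiołkowski state `1^W / dim W`, the normalised projector onto the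
block `W`. For `W` running over the irreducible components of a multiplicity-free `B(H_A)`, these
are the isolated extremal covariant channels. -/
def blockChannel (W : Submodule ℂ (Op d)) : SuperOp d :=
  ofJamiolkowski ((Module.finrank ℂ W : ℂ)⁻¹ • blockProjection W)

/-- `K = min |1 - f(l)|` over the components `l` other than the trivial one. -/
def minGap (U : G →* Matrix.unitaryGroup (Fin d) ℂ) {ι : Type*}
    (V : ι → Subrepresentation (conjRep U)) (f : ι → ℝ) : ℝ :=
  ⨅ l : {l : ι // ¬ (V l).toRepresentation.IsTrivial}, |1 - f l|

end Symmetry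

/-- `J 1, …, J n` are (Hermitian) infinitesimal generators of `U`: for tangent vectors
`x 1, …, x n` spanning the Lie algebra of `G`, the derivative of `U` at the identity along `x k`
is `i J k` (computed entrywise). -/
structure IsGeneratingFamily {m : ℕ} {G : Type*} [Group G] [TopologicalSpace G]
    [ChartedSpace (EuclideanSpace ℝ (Fin m)) G] {d n : ℕ}
    (U : G →* Matrix.unitaryGroup (Fin d) ℂ) (x : Fin n → GroupLieAlgebra (𝓡 m) G)
    (J : Fin n → Op d) : Prop where
  span_eq_top : Submodule.span ℝ (Set.range x) = ⊤
  isHermitian : ∀ k, (J k).IsHermitian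
  derivative : ∀ k i j,
    mfderiv (𝓡 m) 𝓘(ℝ, ℂ) (fun g : G => (U g : Op d) i j) 1 (x k) = Complex.I * J k i j

end CovariantChannel

end

/-! Vectorisation identifies `B(H_A)` with `H_A ⊗ H_A`, so the Jamiołkowski operator of a covariant
channel becomes a superoperator commuting with conjugation by `U`. Since the representation is
multiplicity free, Schur's lemma makes it a scalar on every component, positivity makes these
scalars nonnegative, and trace preservation normalises them: E = ∑ p_l E^l with p a probability
vector (`exists_convex_combination`). Everything is then expressed through p.

Deviation. Each E^l multiplies all generators by f(l) in the Heisenberg picture, so E does so by F =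
∑ p_l f(l). The average of |tr(ψJ)|² over pure states is tr(J²)/(d(d+1)) for traceless Hermitian J,
whence √Δ = (1 - F) ‖J‖ / √(d(d+1)) (`avgDeviation_eq`). Provided some generator is nonzero, f(l) ≤
1, because E^l is completely positive, unital and trace preserving (`eigenvalue_le_one`). Therefore
1 - F = ∑ p_l (1 - f(l)) ≥ K (1 - p_0), where 0 is the component of scalars.

Unitarity. For a unital, trace-preserving E with Hermitian Jamiołkowski operator, u = (N - 1)/(d² -
1), with N the squared Hilbert–Schmidt norm (`unitarity_eq`). The Jamiołkowski operator has
eigenvalue p_0 at |Ω⟩, so N ≥ d² p_0², and (1 - u)(d² - 1) ≤ d²(1 - p_0²) ≤ 2d²(1 - p_0).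
Eliminating p_0 gives (i).

Part (ii) is Schur's lemma applied to the adjoint of E^l on the component that contains all
generators; Hermiticity makes the scalar real. -/

/-! ### Isometry invariance of the surface measure on the sphere. -/

open MeasureTheory Module Pointwise in
-- The surface measure of a set is, up to a constant, the volume of the cone over it; an isometry
-- preserves volume and commutes with taking cones.
theorem MeasureTheory.Measure.toSphere_map_linearIsometryEquiv
    {E : Type*} [NormedAddCommGroup E] [InnerProductSpace ℝ E] [FiniteDimensional ℝ E]
    [MeasurableSpace E] [BorelSpace E] (e : E ≃ₗᵢ[ℝ] E)
    (s : Metric.sphere (0 : E) 1 → Metric.sphere (0 : E) 1) (hs : ∀ ψ, (s ψ : E) = e ψ) :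
    MeasurePreserving s (volume : Measure E).toSphere (volume : Measure E).toSphere := by
  have hsm : Measurable s := by
    refine Continuous.measurable (continuous_induced_rng.2 ?_)
    have : (Subtype.val ∘ s) = fun ψ : Metric.sphere (0 : E) 1 => e ψ.1 := funext hs
    rw [this]
    exact e.continuous.comp continuous_subtype_val
  refine ⟨hsm, ?_⟩
  ext A hA
  rw [Measure.map_apply hsm hA, Measure.toSphere_apply' _ (hsm hA), Measure.toSphere_apply' _ hA]
  congr 1
  rw [← e.measurePreserving.measure_preimage_emb e.toHomeomorph.measurableEmbedding
    (Set.Ioo (0 : ℝ) 1 • (Subtype.val '' A))]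
  congr 1
  ext x
  simp only [Set.mem_smul, Set.mem_image, Set.mem_preimage]
  constructor
  · rintro ⟨r, hr, _, ⟨ψ, hψ, rfl⟩, rfl⟩
    exact ⟨r, hr, _, ⟨s ψ, hψ, rfl⟩, by rw [hs, map_smul]⟩
  · rintro ⟨r, hr, _, ⟨φ, hφ, rfl⟩, hx⟩
    have hn : e.symm φ ∈ Metric.sphere (0 : E) 1 := by simp
    have hsφ : s ⟨e.symm φ, hn⟩ = φ := Subtype.ext (by rw [hs]; simp)
    refine ⟨r, hr, e.symm φ, ⟨⟨e.symm φ, hn⟩, ?_, rfl⟩, ?_⟩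
    · rwa [hsφ]
    · apply e.injective
      rw [map_smul, e.apply_symm_apply, hx]

/-! ### Fourth moments of a Haar random unit vector. -/

namespace CovariantChannel

open MeasureTheory

theorem isProbabilityMeasure_haarState {d : ℕ} (hd : d ≠ 0) :
    IsProbabilityMeasure (haarState d) := by
  have : NeZero d := ⟨hd⟩
  refine ⟨?_⟩
  rw [haarState, Measure.smul_apply, smul_eq_mul]
  refine ENNReal.inv_mul_cancel ?_ (measure_ne_top _ _)
  rw [Ne, Measure.measure_univ_eq_zero]
  exact Measure.toSphere_ne_zero _

theorem integral_haarState_comp {d : ℕ}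
    (e : EuclideanSpace ℂ (Fin d) ≃ₗᵢ[ℝ] EuclideanSpace ℂ (Fin d))
    {g : EuclideanSpace ℂ (Fin d) → ℂ} (hg : Continuous g) :
    ∫ ψ, g (e ψ.1) ∂(haarState d) = ∫ ψ, g ψ.1 ∂(haarState d) := by
  let s : Metric.sphere (0 : EuclideanSpace ℂ (Fin d)) 1 →
      Metric.sphere (0 : EuclideanSpace ℂ (Fin d)) 1 := fun ψ => ⟨e ψ, by simp⟩
  have hs := (Measure.toSphere_map_linearIsometryEquiv e s fun _ => rfl).smul_measure
    ((volume : Measure (EuclideanSpace ℂ (Fin d))).toSphere Set.univ)⁻¹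
  have h2 := hs.map_eq
  change Measure.map s (haarState d) = haarState d at h2
  conv_rhs => rw [← h2]
  rw [integral_map hs.measurable.aemeasurable]
  exact (hg.comp continuous_subtype_val).aestronglyMeasurable

theorem integrable_haarState {d : ℕ} (hd : d ≠ 0) {F : Type*} [NormedAddCommGroup F]
    {g : Metric.sphere (0 : EuclideanSpace ℂ (Fin d)) 1 → F} (hg : Continuous g) :
    Integrable g (haarState d) := by
  have := isProbabilityMeasure_haarState hd
  exact hg.integrable_of_hasCompactSupport (HasCompactSupport.of_compactSpace g)

/-- The fourth moments of the Haar measure on unit vectors. -/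
noncomputable def moment (d : ℕ) (i j k l : Fin d) : ℂ :=
  ∫ ψ, ψ.1 i * star (ψ.1 j) * (ψ.1 k * star (ψ.1 l)) ∂(haarState d)

/-- Invariance under diagonal unitaries; a moment picking up a phase other than 1 must vanish. -/
theorem moment_phase {d : ℕ} (c : Fin d → Circle) (i j k l : Fin d) :
    moment d i j k l = (c i * star (c j : ℂ) * (c k * star (c l : ℂ))) * moment d i j k l := by
  have h := integral_haarState_comp (LinearIsometryEquiv.piLpCongrRight 2 fun i => rotation (c i))
    (g := fun ψ => ψ i * star (ψ j) * (ψ k * star (ψ l))) (by fun_prop)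
  conv_lhs => rw [moment, ← h]
  rw [moment, ← integral_const_mul]
  congr 1
  ext ψ
  simp
  ring

theorem moment_eq_zero {d : ℕ} {i j k l : Fin d} (h₁ : ¬ (i = j ∧ k = l))
    (h₂ : ¬ (i = l ∧ j = k)) : moment d i j k l = 0 := by
  -- The phase is `I` and not `-1`, so that ψ_i² conj(ψ_j ψ_l) with j, l ≠ i is also detected: it
  -- picks up I² = -1.
  let c : Fin d → Fin d → Circle := fun m a =>
    if a = m then ⟨Complex.I, by simp [Submonoid.unitSphere]⟩ else 1
  have hc : ∀ m a, ((c m a : Circle) : ℂ) = if a = m then Complex.I else 1 := by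
    intro m a
    by_cases h : a = m <;> simp [c, h]
  have key : ∃ m, (c m i * star (c m j : ℂ) * (c m k * star (c m l : ℂ))) ≠ 1 := by
    by_cases hij : i = j
    · subst hij
      have hkl : k ≠ l := fun h => h₁ ⟨rfl, h⟩
      refine ⟨k, ?_⟩
      by_cases hik : i = k
      · simp [hc, hik, hkl.symm, Complex.ext_iff]
      · simp [hc, hik, hkl.symm, Complex.ext_iff]
    · by_cases hil : i = l
      · subst hil
        have hjk : j ≠ k := fun h => h₂ ⟨rfl, h⟩
        exact ⟨j, by simp [hc, hij, hjk.symm, Complex.ext_iff]⟩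
      · refine ⟨i, ?_⟩
        by_cases hk : k = i
        · simp [hc, hk, Ne.symm hij, Ne.symm hil, Complex.ext_iff]
          norm_num
        · simp [hc, hk, Ne.symm hij, Ne.symm hil, Complex.ext_iff]
  obtain ⟨m, hm⟩ := key
  have h := moment_phase (c m) i j k l
  have h' : ((c m i * star (c m j : ℂ) * (c m k * star (c m l : ℂ))) - 1) * moment d i j k l = 0 := by
    rw [sub_mul, ← h]; ring
  exact (mul_eq_zero.1 h').resolve_left (sub_ne_zero.2 hm)

/-- `∫ |⟨v, ψ⟩|⁴ dψ` does not depend on the unit vector `v`. -/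
theorem integral_inner_pow_four {d : ℕ} (i : Fin d) (v : EuclideanSpace ℂ (Fin d))
    (hv : ‖v‖ = 1) :
    ∫ ψ, (inner ℂ v ψ.1 * star (inner ℂ v ψ.1)) ^ 2 ∂(haarState d) = moment d i i i i := by
  -- Completing `v` to an orthonormal basis with `v` in position `i` gives a unitary coordinate map
  -- that turns ⟨v, ψ⟩ into the i-th coordinate.
  obtain ⟨b, hb⟩ := Orthonormal.exists_orthonormalBasis_extension_of_card_eq (𝕜 := ℂ)
    (E := EuclideanSpace ℂ (Fin d)) (ι := Fin d) (by simp) (v := fun _ => v) (s := {i})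
    (by
      constructor
      · intro a; simpa using hv
      · intro a a' h
        exact absurd (Subsingleton.elim a a') h)
  have h := integral_haarState_comp
    ({ b.repr.toLinearEquiv.restrictScalars ℝ with norm_map' := b.repr.norm_map } :
      EuclideanSpace ℂ (Fin d) ≃ₗᵢ[ℝ] EuclideanSpace ℂ (Fin d))
    (g := fun ψ => ψ i * star (ψ i) * (ψ i * star (ψ i))) (by fun_prop)
  rw [moment, ← h]
  congr 1
  ext ψ
  have : inner ℂ v ψ.1 = b.repr ψ.1 i := by
    rw [b.repr_apply_apply, hb i rfl]
  rw [this, sq]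
  rfl

theorem moment_diag_eq {d : ℕ} (i j : Fin d) : moment d i i i i = moment d j j j j := by
  rw [← integral_inner_pow_four i (EuclideanSpace.single j 1) (by simp),
    ← integral_inner_pow_four j (EuclideanSpace.single j 1) (by simp)]

/-- Polarisation: summing |⟨v, ψ⟩|⁴ over v = (e_i + z e_j)/√2 with z⁴ = 1 leaves |ψ_i|⁴ + |ψ_j|⁴ +
4|ψ_i|²|ψ_j|². Each of the four terms, and each of the two fourth powers, has the same integral A,
so 4A = 2A + 4B, where B is the mixed moment. -/
theorem moment_diag_eq_two_mul {d : ℕ} {i j : Fin d} (hij : i ≠ j) :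
    moment d i i i i = 2 * moment d i i j j := by
  have hd : d ≠ 0 := fun h => by subst h; exact i.elim0
  let v : ℂ → EuclideanSpace ℂ (Fin d) := fun z =>
    ((Real.sqrt 2)⁻¹ : ℂ) • (EuclideanSpace.single i (1 : ℂ) + EuclideanSpace.single j z)
  have hv : ∀ z : ℂ, ‖z‖ = 1 → ‖v z‖ = 1 := by
    intro z hz
    have h : ‖EuclideanSpace.single i (1 : ℂ) + EuclideanSpace.single j z‖ = Real.sqrt 2 := by
      rw [eq_comm, Real.sqrt_eq_iff_mul_self_eq (by norm_num) (norm_nonneg _),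
        @norm_add_sq_eq_norm_sq_add_norm_sq_of_inner_eq_zero ℂ]
      · rw [PiLp.norm_single, PiLp.norm_single, hz]
        norm_num
      · rw [EuclideanSpace.inner_single_left]
        simp [hij]
    change ‖((Real.sqrt 2)⁻¹ : ℂ) • (EuclideanSpace.single i (1 : ℂ) +
      EuclideanSpace.single j z)‖ = 1
    rw [norm_smul, h]
    simp [abs_of_nonneg (Real.sqrt_nonneg 2)]
  have hs : ((Real.sqrt 2 : ℂ)⁻¹) * (Real.sqrt 2 : ℂ)⁻¹ = 1 / 2 := by
    rw [← mul_inv, ← Complex.ofReal_mul, Real.mul_self_sqrt (by norm_num)]; norm_num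
  have hin : ∀ z (ψ : EuclideanSpace ℂ (Fin d)),
      inner ℂ (v z) ψ = (Real.sqrt 2 : ℂ)⁻¹ * (ψ i + star z * ψ j) := by
    intro z ψ
    rw [show v z = _ from rfl, inner_smul_left, inner_add_left, EuclideanSpace.inner_single_left,
      EuclideanSpace.inner_single_left]
    simp
  have hint : ∀ z, Integrable (fun ψ : Metric.sphere (0 : EuclideanSpace ℂ (Fin d)) 1 =>
      (inner ℂ (v z) ψ.1 * star (inner ℂ (v z) ψ.1)) ^ 2) (haarState d) :=
    fun z => integrable_haarState hd (by fun_prop)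
  have hmint : ∀ i j k l : Fin d, Integrable
      (fun ψ : Metric.sphere (0 : EuclideanSpace ℂ (Fin d)) 1 =>
        ψ.1 i * star (ψ.1 j) * (ψ.1 k * star (ψ.1 l))) (haarState d) :=
    fun i j k l => integrable_haarState hd (by fun_prop)
  have key : ∫ ψ, ((inner ℂ (v 1) ψ.1 * star (inner ℂ (v 1) ψ.1)) ^ 2
        + (inner ℂ (v (-1)) ψ.1 * star (inner ℂ (v (-1)) ψ.1)) ^ 2
        + (inner ℂ (v Complex.I) ψ.1 * star (inner ℂ (v Complex.I) ψ.1)) ^ 2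
        + (inner ℂ (v (-Complex.I)) ψ.1 * star (inner ℂ (v (-Complex.I)) ψ.1)) ^ 2)
          ∂(haarState d) =
      ∫ ψ, (ψ.1 i * star (ψ.1 i) * (ψ.1 i * star (ψ.1 i))
        + ψ.1 j * star (ψ.1 j) * (ψ.1 j * star (ψ.1 j))
        + 4 * (ψ.1 i * star (ψ.1 i) * (ψ.1 j * star (ψ.1 j)))) ∂(haarState d) := by
    congr 1
    ext ψ
    simp only [hin, star_mul', star_add, star_inv₀, RCLike.star_def,
      Complex.conj_ofReal, map_one, map_neg, Complex.conj_I]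
    generalize (Real.sqrt 2 : ℂ)⁻¹ = r at hs
    have hI := Complex.I_mul_I
    generalize Complex.I = I at hI
    have hI2 : I ^ 2 = -1 := by rw [sq, hI]
    have hI4 : I ^ 4 = 1 := by rw [show 4 = 2 * 2 from rfl, pow_mul, hI2]; norm_num
    have hr : r ^ 4 = 1 / 4 := by rw [show r ^ 4 = (r * r) ^ 2 by ring, hs]; norm_num
    ring_nf
    rw [hI2, hI4, hr]
    ring
  rw [integral_add (by exact ((hint 1).add (hint _)).add (hint _)) (hint _),
    integral_add (by exact (hint 1).add (hint _)) (hint _), integral_add (hint 1) (hint _),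
    integral_add (by exact (hmint _ _ _ _).add (hmint _ _ _ _))
      (by exact (hmint _ _ _ _).const_mul _),
    integral_add (hmint _ _ _ _) (hmint _ _ _ _), integral_const_mul,
    integral_inner_pow_four i _ (hv _ (by simp)), integral_inner_pow_four i _ (hv _ (by simp)),
    integral_inner_pow_four i _ (hv _ (by simp)), integral_inner_pow_four i _ (hv _ (by simp))]
    at key
  change _ = moment d i i i i + moment d j j j j + 4 * moment d i i j j at key
  rw [← moment_diag_eq i j] at key
  linear_combination (1 / 2 : ℂ) * key

theorem sum_mul_star_eq_one {d : ℕ} (ψ : Metric.sphere (0 : EuclideanSpace ℂ (Fin d)) 1) :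
    ∑ i, ψ.1 i * star (ψ.1 i) = 1 := by
  have h : ‖ψ.1‖ = 1 := by simp
  have h2 := EuclideanSpace.norm_sq_eq ψ.1
  rw [h] at h2
  simp only [RCLike.star_def, Complex.mul_conj, Complex.normSq_eq_norm_sq]
  exact_mod_cast (by linarith : ∑ i, ‖ψ.1 i‖ ^ 2 = 1)

theorem sum_moment_eq_one {d : ℕ} (hd : d ≠ 0) : ∑ i, ∑ j, moment d i i j j = 1 := by
  have := isProbabilityMeasure_haarState hd
  have hmint : ∀ i j k l : Fin d, Integrable
      (fun ψ : Metric.sphere (0 : EuclideanSpace ℂ (Fin d)) 1 =>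
        ψ.1 i * star (ψ.1 j) * (ψ.1 k * star (ψ.1 l))) (haarState d) :=
    fun i j k l => integrable_haarState hd (by fun_prop)
  have : ∀ ψ : Metric.sphere (0 : EuclideanSpace ℂ (Fin d)) 1,
      ∑ i, ∑ j, ψ.1 i * star (ψ.1 i) * (ψ.1 j * star (ψ.1 j)) = 1 := by
    intro ψ
    rw [← Finset.sum_mul_sum, sum_mul_star_eq_one, one_mul]
  calc ∑ i, ∑ j, moment d i i j j
      = ∫ ψ, ∑ i, ∑ j, ψ.1 i * star (ψ.1 i) * (ψ.1 j * star (ψ.1 j)) ∂(haarState d) := by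
        rw [integral_finsetSum _ fun i _ => integrable_finsetSum _ fun j _ => hmint i i j j]
        refine Finset.sum_congr rfl fun i _ => ?_
        rw [integral_finsetSum _ fun j _ => hmint i i j j]
        rfl
    _ = 1 := by simp only [this, integral_const, probReal_univ, one_smul]

/-- Phases leave only the two index pairings, and polarisation relates all surviving moments to one
number A. Integrating (∑ |ψ_i|²)² = 1 gives A = 2/(d(d+1)). -/
theorem moment_eq {d : ℕ} (i j k l : Fin d) :
    moment d i j k l = ((if i = j ∧ k = l then 1 else 0) + (if i = l ∧ j = k then 1 else 0)) /
      (d * (d + 1)) := by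
  have hd : d ≠ 0 := fun h => by subst h; exact i.elim0
  have hd0 : (d : ℂ) ≠ 0 := by exact_mod_cast hd
  have hd1 : (d : ℂ) + 1 ≠ 0 := by exact_mod_cast Nat.succ_ne_zero d
  set A := moment d i i i i with hA
  have hAi : ∀ j, moment d j j j j = A := fun j => moment_diag_eq j i
  have hB : ∀ i j, i ≠ j → moment d i i j j = A / 2 := by
    intro i j hij
    rw [← hAi i, moment_diag_eq_two_mul hij]; ring
  have hall : ∀ i j, moment d i i j j = A / 2 + if i = j then A / 2 else 0 := by
    intro i j
    by_cases h : i = j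
    · subst h; rw [hAi]; simp
    · rw [hB _ _ h]; simp [h]
  have hsum := sum_moment_eq_one hd
  simp only [hall, Finset.sum_add_distrib, Finset.sum_ite_eq, Finset.mem_univ, if_true,
    Finset.sum_const, Finset.card_univ, Fintype.card_fin, nsmul_eq_mul] at hsum
  have hA' : A = 2 / (d * (d + 1)) := by
    field_simp
    linear_combination 2 * hsum
  by_cases h₁ : i = j ∧ k = l
  · obtain ⟨rfl, rfl⟩ := h₁
    rw [hall, hA']
    by_cases h : i = k
    · simp [h]; ring
    · simp [h]; field_simp
  · by_cases h₂ : i = l ∧ j = k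
    · obtain ⟨rfl, rfl⟩ := h₂
      have h : i ≠ j := fun h => h₁ ⟨h, h.symm⟩
      have hsw : moment d i j j i = moment d i i j j := by
        rw [moment, moment]
        congr 1
        ext ψ
        ring
      rw [hsw, hB _ _ h, hA']
      simp [h]; field_simp
    · rw [moment_eq_zero h₁ h₂]
      simp [h₁, h₂]

theorem pureState_eq_sum {d : ℕ} (ψ : Metric.sphere (0 : EuclideanSpace ℂ (Fin d)) 1) :
    pureState ψ = ∑ i, ∑ j, (ψ.1 i * star (ψ.1 j)) • Matrix.single i j (1 : ℂ) := by
  conv_lhs => rw [Matrix.matrix_eq_sum_single (pureState ψ)]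
  simp [pureState, Matrix.smul_single]

theorem continuous_pureState {d : ℕ} : Continuous (pureState (d := d)) :=
  continuous_pi fun i => continuous_pi fun j => by
    simp only [pureState, Matrix.of_apply]
    fun_prop

/-- The Haar average of a bilinear function of two copies of a random pure state. -/
theorem integral_bilinear_pureState {d : ℕ} (hd : d ≠ 0) (β : Op d →ₗ[ℂ] Op d →ₗ[ℂ] ℂ) :
    ∫ ψ, β (pureState ψ) (pureState ψ) ∂(haarState d) =
      (β 1 1 + ∑ i, ∑ j, β (Matrix.single i j 1) (Matrix.single j i 1)) / (d * (d + 1)) := by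
  have hint : ∀ i j k l : Fin d, ∀ c : ℂ, Integrable
      (fun ψ : Metric.sphere (0 : EuclideanSpace ℂ (Fin d)) 1 =>
        ψ.1 i * star (ψ.1 j) * (ψ.1 k * star (ψ.1 l)) * c) (haarState d) :=
    fun i j k l c => integrable_haarState hd (by fun_prop)
  have hexp : ∀ ψ : Metric.sphere (0 : EuclideanSpace ℂ (Fin d)) 1,
      β (pureState ψ) (pureState ψ) = ∑ i, ∑ j, ∑ k, ∑ l,
        ψ.1 i * star (ψ.1 j) * (ψ.1 k * star (ψ.1 l)) *
          β (Matrix.single i j 1) (Matrix.single k l 1) := by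
    intro ψ
    have hX : ∀ Y, β (pureState ψ) Y =
        ∑ i, ∑ j, (ψ.1 i * star (ψ.1 j)) * β (Matrix.single i j 1) Y := by
      intro Y
      rw [pureState_eq_sum]
      simp only [map_sum, map_smul, LinearMap.sum_apply, LinearMap.smul_apply, smul_eq_mul]
    rw [hX]
    refine Finset.sum_congr rfl fun i _ => Finset.sum_congr rfl fun j _ => ?_
    conv_lhs => rw [pureState_eq_sum]
    simp only [map_sum, map_smul, smul_eq_mul, Finset.mul_sum, mul_assoc]
  simp only [hexp]
  have h1 : ∫ ψ, ∑ i, ∑ j, ∑ k, ∑ l, ψ.1 i * star (ψ.1 j) * (ψ.1 k * star (ψ.1 l)) *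
          β (Matrix.single i j 1) (Matrix.single k l 1) ∂(haarState d) =
      ∑ i, ∑ j, ∑ k, ∑ l,
        moment d i j k l * β (Matrix.single i j 1) (Matrix.single k l 1) := by
    rw [integral_finsetSum _ fun i _ => integrable_finsetSum _ fun j _ =>
      integrable_finsetSum _ fun k _ => integrable_finsetSum _ fun l _ => hint i j k l _]
    refine Finset.sum_congr rfl fun i _ => ?_
    rw [integral_finsetSum _ fun j _ =>
      integrable_finsetSum _ fun k _ => integrable_finsetSum _ fun l _ => hint i j k l _]
    refine Finset.sum_congr rfl fun j _ => ?_
    rw [integral_finsetSum _ fun k _ => integrable_finsetSum _ fun l _ => hint i j k l _]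
    refine Finset.sum_congr rfl fun k _ => ?_
    rw [integral_finsetSum _ fun l _ => hint i j k l _]
    refine Finset.sum_congr rfl fun l _ => ?_
    rw [integral_mul_const, moment]
  have hone : (1 : Op d) = ∑ i, Matrix.single i i 1 := by
    ext a b
    simp [Matrix.sum_apply, Matrix.single_apply, Matrix.one_apply, ite_and]
  have hb : β 1 1 = ∑ i, ∑ k, β (Matrix.single i i 1) (Matrix.single k k 1) := by
    rw [hone]
    simp only [map_sum, LinearMap.sum_apply]
    exact Finset.sum_comm
  have h2 : ∀ i j k l : Fin d, moment d i j k l * β (Matrix.single i j 1) (Matrix.single k l 1) =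
      (if i = j then if k = l then β (Matrix.single i j 1) (Matrix.single k l 1) else 0 else 0) /
        (d * (d + 1)) +
      (if i = l then if j = k then β (Matrix.single i j 1) (Matrix.single k l 1) else 0 else 0) /
        (d * (d + 1)) := by
    intro i j k l
    rw [moment_eq, ite_and, ite_and]
    split_ifs <;> ring
  rw [h1, hb, add_div]
  simp only [h2, Finset.sum_add_distrib, Finset.sum_ite_irrel, Finset.sum_ite_eq,
    Finset.mem_univ, if_true, Finset.sum_const_zero, ← Finset.sum_div]

end CovariantChannel

/-! ### Schur's lemma for the multiplicity-free decomposition. -/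

namespace CovariantChannel

section Schur

variable {G : Type*} [Group G] {d : ℕ} {U : G →* Matrix.unitaryGroup (Fin d) ℂ}
  {ι : Type*} [DecidableEq ι] {V : ι → Subrepresentation (conjRep U)}

theorem conjRep_apply (g : G) (X : Op d) :
    conjRep U g X = (U g : Op d) * X * (U g : Op d).conjTranspose := rfl

theorem IsMultiplicityFreeDecomposition.bijective_coeLinearMap
    (hV : IsMultiplicityFreeDecomposition U V) :
    Function.Bijective (DirectSum.coeLinearMap fun l => (V l).toSubmodule) := hV.isInternal

/-- The projection onto a component along the other ones. -/
noncomputable def IsMultiplicityFreeDecomposition.proj (hV : IsMultiplicityFreeDecomposition U V)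
    (l : ι) : Op d →ₗ[ℂ] (V l).toSubmodule :=
  DirectSum.component ℂ ι (fun l => (V l).toSubmodule) l ∘ₗ
    (LinearEquiv.ofBijective (DirectSum.coeLinearMap fun l => (V l).toSubmodule)
      hV.bijective_coeLinearMap).symm.toLinearMap

namespace IsMultiplicityFreeDecomposition

theorem proj_of_mem (hV : IsMultiplicityFreeDecomposition U V) {l m : ι} {X : Op d}
    (hX : X ∈ (V m).toSubmodule) : (hV.proj l X : Op d) = if m = l then X else 0 := by
  have h : (LinearEquiv.ofBijective (DirectSum.coeLinearMap fun l => (V l).toSubmodule)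
      hV.bijective_coeLinearMap).symm X = DirectSum.lof ℂ ι (fun l => (V l).toSubmodule) m ⟨X, hX⟩ := by
    rw [LinearEquiv.symm_apply_eq]
    simp
  simp only [proj, LinearMap.comp_apply, LinearEquiv.coe_coe, h]
  by_cases hml : m = l
  · subst hml
    simp [DirectSum.component.lof_self]
  · rw [DirectSum.component.of]
    simp [hml]

theorem exists_mem_ne_zero (hV : IsMultiplicityFreeDecomposition U V) (l : ι) :
    ∃ X ∈ (V l).toSubmodule, X ≠ 0 := by
  by_contra! h
  have := hV.irreducible l
  have hbt := bot_ne_top (α := Subrepresentation (V l).toRepresentation)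
  apply hbt
  ext X
  have : X = 0 := Subtype.ext (h X.1 X.2)
  subst this
  exact ⟨fun _ => Submodule.zero_mem _, fun _ => Submodule.zero_mem _⟩

theorem eq_zero_of_mem_of_mem (hV : IsMultiplicityFreeDecomposition U V) {l m : ι} (hlm : l ≠ m)
    {X : Op d} (hl : X ∈ (V l).toSubmodule) (hm : X ∈ (V m).toSubmodule) : X = 0 := by
  have h1 := hV.proj_of_mem (l := l) hl
  rw [hV.proj_of_mem (l := l) hm] at h1
  simpa [hlm.symm] using h1.symm

variable [Fintype ι]

theorem sum_proj (hV : IsMultiplicityFreeDecomposition U V) (X : Op d) :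
    ∑ l, (hV.proj l X : Op d) = X := by
  set e := LinearEquiv.ofBijective (DirectSum.coeLinearMap fun l => (V l).toSubmodule)
    hV.bijective_coeLinearMap
  obtain ⟨x, rfl⟩ := e.surjective X
  have h : ∀ l, (hV.proj l (e x) : Op d) = x l := by
    intro l
    simp only [proj, LinearMap.comp_apply, LinearEquiv.coe_coe]
    rw [LinearEquiv.symm_apply_apply]
    rfl
  simp only [h]
  change _ = DirectSum.coeLinearMap (fun l => (V l).toSubmodule) x
  rw [DirectSum.coeLinearMap_eq_dfinsuppSum, DFinsupp.sum_eq_sum_fintype]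
  · rfl
  · exact fun _ => rfl

theorem ext_of_mem (hV : IsMultiplicityFreeDecomposition U V) {M : Type*} [AddCommMonoid M]
    [Module ℂ M] {S T : Op d →ₗ[ℂ] M} (h : ∀ l, ∀ X ∈ (V l).toSubmodule, S X = T X) : S = T := by
  ext1 X
  rw [← hV.sum_proj X, map_sum, map_sum]
  exact Finset.sum_congr rfl fun l _ => h l _ (hV.proj l X).2

theorem proj_conjRep (hV : IsMultiplicityFreeDecomposition U V) (l : ι) (g : G) (X : Op d) :
    (hV.proj l (conjRep U g X) : Op d) = conjRep U g (hV.proj l X) := by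
  have : (V l).toSubmodule.subtype ∘ₗ hV.proj l ∘ₗ conjRep U g =
      conjRep U g ∘ₗ (V l).toSubmodule.subtype ∘ₗ hV.proj l := by
    refine hV.ext_of_mem fun m Y hY => ?_
    simp only [LinearMap.comp_apply, Submodule.subtype_apply]
    rw [hV.proj_of_mem ((V m).apply_mem_toSubmodule g hY), hV.proj_of_mem hY]
    split_ifs <;> simp
  exact LinearMap.congr_fun this X

/-- Schur's lemma: a covariant superoperator acts on each component as a scalar. -/
theorem exists_scalar (hV : IsMultiplicityFreeDecomposition U V) {T : SuperOp d}
    (hT : IsCovariant U T) : ∃ c : ι → ℂ, ∀ l, ∀ X ∈ (V l).toSubmodule, T X = c l • X := by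
  let f : ∀ l m, Representation.IntertwiningMap (V l).toRepresentation (V m).toRepresentation :=
    fun l m =>
      { toLinearMap := hV.proj m ∘ₗ T ∘ₗ (V l).toSubmodule.subtype
        isIntertwining' := by
          intro g
          ext1 X
          apply Subtype.ext
          change (hV.proj m (T (conjRep U g X)) : Op d) = conjRep U g (hV.proj m (T X))
          rw [hT, hV.proj_conjRep] }
  have hf : ∀ l m (X : (V l).toSubmodule), f l m X = hV.proj m (T X) := fun _ _ _ => rfl
  have hne : ∀ l m, l ≠ m → f l m = 0 := by
    intro l m hlm
    have := hV.irreducible l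
    have := hV.irreducible m
    have := hV.inequivalent l m hlm
    exact Subsingleton.elim _ _
  have hex : ∀ l, ∃ c : ℂ, f l l = algebraMap ℂ _ c := by
    intro l
    have := hV.irreducible l
    obtain ⟨c, hc⟩ := (Representation.IsIrreducible.algebraMap_intertwiningMap_bijective_of_isAlgClosed
      (k := ℂ) (ρ := (V l).toRepresentation)).2 (f l l)
    exact ⟨c, hc.symm⟩
  choose c hc using hex
  refine ⟨c, fun l X hX => ?_⟩
  rw [← hV.sum_proj (T X), Finset.sum_eq_single l]
  · rw [← hf l l ⟨X, hX⟩, hc]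
    rfl
  · intro m _ hm
    rw [← hf l m ⟨X, hX⟩, hne l m hm.symm]
    rfl
  · simp

/-- Feeding these rank-one maps to Schur's lemma locates the invariant operators among the
components. -/
theorem isCovariant_trace_smul {M : Op d} (hM : ∀ g, conjRep U g M = M) :
    IsCovariant U ((Matrix.traceLinearMap (Fin d) ℂ ℂ).smulRight M) := by
  intro g X
  have h : (conjRep U g X).trace = X.trace := by
    rw [conjRep_apply, Matrix.trace_mul_comm, ← mul_assoc]
    have : (U g : Op d).conjTranspose * (U g : Op d) = 1 := (U g).2.1
    rw [this, one_mul]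
  simp [h, hM]

theorem conjRep_one_apply (g : G) : conjRep U g (1 : Op d) = 1 := by
  rw [conjRep_apply, mul_one]
  exact (U g).2.2

/-- The scalars form one component; the other ones are traceless and nontrivial. -/
theorem exists_trivial_component (hV : IsMultiplicityFreeDecomposition U V) (hd : d ≠ 0) :
    ∃ l₀, (1 : Op d) ∈ (V l₀).toSubmodule ∧ (∀ X ∈ (V l₀).toSubmodule, ∃ c : ℂ, X = c • 1) ∧
      ∀ l, l ≠ l₀ → (∀ X ∈ (V l).toSubmodule, X.trace = 0) ∧
        ¬ (V l).toRepresentation.IsTrivial := by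
  have hd0 : (d : ℂ) ≠ 0 := by exact_mod_cast hd
  have hne : NeZero d := ⟨hd⟩
  -- On each component tr(X) 1 is a multiple of X, so a component with an element of nonzero trace
  -- contains 1.
  obtain ⟨c, hc⟩ := hV.exists_scalar (isCovariant_trace_smul (U := U) conjRep_one_apply)
  simp only [LinearMap.smulRight_apply, Matrix.traceLinearMap_apply] at hc
  have h1 : ∃ l₀, ∃ X ∈ (V l₀).toSubmodule, X.trace ≠ 0 := by
    by_contra! h
    have h2 : Matrix.traceLinearMap (Fin d) ℂ ℂ = 0 := hV.ext_of_mem h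
    have h3 := LinearMap.congr_fun h2 (1 : Op d)
    simp [hd] at h3
  obtain ⟨l₀, X, hX, hXt⟩ := h1
  have hcl : c l₀ ≠ 0 := by
    intro h0
    have h2 := hc l₀ X hX
    rw [h0, zero_smul, smul_eq_zero] at h2
    exact h2.elim hXt one_ne_zero
  have h1mem : (1 : Op d) ∈ (V l₀).toSubmodule := by
    have : (1 : Op d) = (X.trace⁻¹ * c l₀) • X := by
      rw [mul_smul, ← hc l₀ X hX, smul_smul, inv_mul_cancel₀ hXt, one_smul]
    rw [this]
    exact Submodule.smul_mem _ _ hX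
  refine ⟨l₀, h1mem, fun Y hY => ⟨(c l₀)⁻¹ * Y.trace, ?_⟩, fun l hl => ⟨fun Y hY => ?_, ?_⟩⟩
  · rw [mul_smul, hc l₀ Y hY, smul_smul, inv_mul_cancel₀ hcl, one_smul]
  · by_contra hYt
    have h2 : (1 : Op d) = (Y.trace⁻¹ * c l) • Y := by
      rw [mul_smul, ← hc l Y hY, smul_smul, inv_mul_cancel₀ hYt, one_smul]
    have h3 : (1 : Op d) ∈ (V l).toSubmodule := by
      rw [h2]
      exact Submodule.smul_mem _ _ hY
    exact one_ne_zero (hV.eq_zero_of_mem_of_mem hl h3 h1mem)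
  · intro htriv
    obtain ⟨Y, hY, hY0⟩ := hV.exists_mem_ne_zero l
    have hinv : ∀ g, conjRep U g Y = Y := by
      intro g
      have := LinearMap.congr_fun (htriv.out g) ⟨Y, hY⟩
      exact congrArg Subtype.val this
    -- Evaluating X ↦ tr(X) Y at 1 shows that the invariant Y is a scalar matrix, hence lies in two
    -- different components.
    obtain ⟨c', hc'⟩ := hV.exists_scalar (isCovariant_trace_smul (U := U) hinv)
    have h2 := hc' l₀ 1 h1mem
    simp only [LinearMap.smulRight_apply, Matrix.traceLinearMap_apply, Matrix.trace_one,
      Fintype.card_fin] at h2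
    have h3 : Y = ((d : ℂ)⁻¹ * c' l₀) • (1 : Op d) := by
      rw [mul_smul, ← h2, smul_smul, inv_mul_cancel₀ hd0, one_smul]
    refine hY0 (hV.eq_zero_of_mem_of_mem hl hY ?_)
    rw [h3]
    exact Submodule.smul_mem _ _ h1mem

/-- A covariant superoperator multiplies the identity and all traces by the same scalar. -/
theorem exists_map_one_trace (hV : IsMultiplicityFreeDecomposition U V) (hd : d ≠ 0)
    {T : SuperOp d} (hT : IsCovariant U T) :
    ∃ c : ℂ, T 1 = c • 1 ∧ ∀ X, (T X).trace = c * X.trace := by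
  obtain ⟨l₀, h1, -, h0⟩ := hV.exists_trivial_component hd
  obtain ⟨c, hc⟩ := hV.exists_scalar hT
  refine ⟨c l₀, hc l₀ 1 h1, fun X => ?_⟩
  have : Matrix.traceLinearMap (Fin d) ℂ ℂ ∘ₗ T = c l₀ • Matrix.traceLinearMap (Fin d) ℂ ℂ := by
    refine hV.ext_of_mem fun l Y hY => ?_
    by_cases hl : l = l₀
    · subst hl
      simp [hc l Y hY]
    · simp [hc l Y hY, (h0 l hl).1 Y hY]
  exact LinearMap.congr_fun this X

end IsMultiplicityFreeDecomposition

end Schur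

/-! ### Covariance of the Jamiołkowski operator. -/

section Reshuffle

variable {d : ℕ}

/-- The superoperator `X ↦ ∑ a a', E(|a⟩⟨a'|) X |a'⟩⟨a|`. -/
noncomputable def reshuffle (E : SuperOp d) : SuperOp d :=
  ∑ a, ∑ a', LinearMap.mulLeft ℂ (E (Matrix.single a a' 1)) ∘ₗ
    LinearMap.mulRight ℂ (Matrix.single a' a (1 : ℂ))

theorem reshuffle_apply (E : SuperOp d) (X : Op d) :
    reshuffle E X = ∑ a, ∑ a', E (Matrix.single a a' 1) * (X * Matrix.single a' a 1) := by
  simp [reshuffle]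

theorem reshuffle_apply_apply (E : SuperOp d) (X : Op d) (b b' : Fin d) :
    reshuffle E X b b' = ∑ k, ∑ a, E (Matrix.single b' a 1) b k * X k a := by
  rw [reshuffle_apply]
  simp only [Matrix.sum_apply, ← mul_assoc]
  rw [Finset.sum_eq_single b', Finset.sum_comm]
  · refine Finset.sum_congr rfl fun a _ => ?_
    simp [Matrix.mul_apply, Matrix.single_apply]
  · intro a _ ha
    refine Finset.sum_eq_zero fun a' _ => ?_
    rw [Matrix.mul_single_apply_of_ne]
    exact ha.symm
  · simp

/-- The tensor ∑ |a⟩⟨a'| ⊗ |a'⟩⟨a| is the flip, which commutes with W ⊗ W. Hence `reshuffle` does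
not depend on the orthonormal basis and preserves covariance. -/
theorem sum_bilinear_conj {M : Type*} [AddCommGroup M] [Module ℂ M]
    (L : Op d →ₗ[ℂ] Op d →ₗ[ℂ] M) {W : Op d} (hW : W * W.conjTranspose = 1) :
    ∑ a, ∑ a', L (W * Matrix.single a a' 1 * W.conjTranspose)
        (W * Matrix.single a' a 1 * W.conjTranspose) =
      ∑ a, ∑ a', L (Matrix.single a a' 1) (Matrix.single a' a 1) := by
  have h1 : ∀ a a', W * Matrix.single a a' 1 * W.conjTranspose =
      ∑ c, ∑ c', (W c a * star (W c' a')) • Matrix.single c c' (1 : ℂ) := by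
    intro a a'
    conv_lhs => rw [Matrix.matrix_eq_sum_single (W * Matrix.single a a' 1 * W.conjTranspose)]
    refine Finset.sum_congr rfl fun c _ => Finset.sum_congr rfl fun c' _ => ?_
    rw [Matrix.smul_single, smul_eq_mul, mul_one]
    congr 1
    simp [Matrix.mul_apply, Matrix.single_apply, ite_and]
  have h2 : ∀ c c', ∑ a, ∑ a', (W c a * star (W c' a')) • Matrix.single a' a (1 : ℂ) =
      W.conjTranspose * Matrix.single c' c 1 * W := by
    intro c c'
    rw [Matrix.matrix_eq_sum_single (W.conjTranspose * Matrix.single c' c 1 * W), Finset.sum_comm]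
    refine Finset.sum_congr rfl fun a' _ => Finset.sum_congr rfl fun a _ => ?_
    rw [Matrix.smul_single, smul_eq_mul, mul_one]
    congr 1
    simp [Matrix.mul_apply, Matrix.single_apply, ite_and, mul_comm]
  have h3 : ∀ c c', L (Matrix.single c c' 1) (Matrix.single c' c 1) =
      ∑ a, ∑ a', (W c a * star (W c' a')) •
        L (Matrix.single c c' 1) (W * Matrix.single a' a 1 * W.conjTranspose) := by
    intro c c'
    have : Matrix.single c' c (1 : ℂ) = ∑ a, ∑ a', (W c a * star (W c' a')) •
        (W * Matrix.single a' a 1 * W.conjTranspose) := by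
      have h4 : W * (W.conjTranspose * Matrix.single c' c 1 * W) * W.conjTranspose =
          Matrix.single c' c (1 : ℂ) := by
        rw [mul_assoc, mul_assoc (W.conjTranspose * _), hW, mul_one, ← mul_assoc, hW, one_mul]
      rw [← h4, ← h2]
      simp only [Finset.mul_sum, Finset.sum_mul, mul_smul_comm, smul_mul_assoc]
    conv_lhs => rw [this]
    simp only [map_sum, map_smul]
  simp only [h3]
  have h5 : ∀ a a', L (W * Matrix.single a a' 1 * W.conjTranspose)
      (W * Matrix.single a' a 1 * W.conjTranspose) = ∑ c, ∑ c', (W c a * star (W c' a')) •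
        L (Matrix.single c c' 1) (W * Matrix.single a' a 1 * W.conjTranspose) := by
    intro a a'
    conv_lhs => rw [h1 a a']
    simp only [map_sum, map_smul, LinearMap.sum_apply, LinearMap.smul_apply]
  simp only [h5]
  calc _ = ∑ a, ∑ c, ∑ a', ∑ c', (W c a * star (W c' a')) •
        L (Matrix.single c c' 1) (W * Matrix.single a' a 1 * W.conjTranspose) :=
        Finset.sum_congr rfl fun a _ => Finset.sum_comm
    _ = _ := Finset.sum_comm
    _ = ∑ c, ∑ a, ∑ c', ∑ a', (W c a * star (W c' a')) •
        L (Matrix.single c c' 1) (W * Matrix.single a' a 1 * W.conjTranspose) :=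
        Finset.sum_congr rfl fun c _ => Finset.sum_congr rfl fun a _ => Finset.sum_comm
    _ = _ := Finset.sum_congr rfl fun c _ => Finset.sum_comm

theorem IsCovariant.reshuffle {G : Type*} [Group G] {U : G →* Matrix.unitaryGroup (Fin d) ℂ}
    {E : SuperOp d} (hE : IsCovariant U E) : IsCovariant U (reshuffle E) := by
  intro g X
  have hW : (U g : Op d) * (U g : Op d).conjTranspose = 1 := (U g).2.2
  have hW' : (U g : Op d).conjTranspose * (U g : Op d) = 1 := (U g).2.1
  have h := sum_bilinear_conj ((LinearMap.mul ℂ (Op d)).compl₁₂ E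
    (LinearMap.mulLeft ℂ (conjRep U g X))) hW
  simp only [LinearMap.compl₁₂_apply, LinearMap.mul_apply', LinearMap.mulLeft_apply] at h
  rw [reshuffle_apply, ← h, reshuffle_apply, map_sum]
  refine Finset.sum_congr rfl fun a _ => ?_
  rw [map_sum]
  refine Finset.sum_congr rfl fun a' _ => ?_
  rw [← conjRep_apply, ← conjRep_apply, hE, conjRep_apply, conjRep_apply, conjRep_apply,
    conjRep_apply]
  simp only [mul_assoc]
  congr 2
  simp only [← mul_assoc, hW', one_mul]

/-- The operator on `H_A ⊗ H_A` with matrix `J`, regarded as a superoperator through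
vectorisation. -/
noncomputable def vecMap (J : Matrix (Fin d × Fin d) (Fin d × Fin d) ℂ) : SuperOp d where
  toFun X := Matrix.of fun b a => ∑ q : Fin d × Fin d, J (b, a) q * X q.1 q.2
  map_add' X Y := by
    ext b a
    simp [mul_add, Finset.sum_add_distrib]
  map_smul' c X := by
    ext b a
    simp [Finset.mul_sum, mul_left_comm]

theorem vecMap_single (J : Matrix (Fin d × Fin d) (Fin d × Fin d) ℂ) (p q : Fin d × Fin d) :
    vecMap J (Matrix.single q.1 q.2 1) p.1 p.2 = J p q := by
  simp only [vecMap, LinearMap.coe_mk, AddHom.coe_mk, Matrix.of_apply, Matrix.single_apply,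
    ← Prod.ext_iff]
  simp

theorem vecMap_injective : Function.Injective (vecMap (d := d)) := by
  intro J K h
  ext p q
  rw [← vecMap_single J, ← vecMap_single K, h]

theorem reshuffle_vecMap (J : Matrix (Fin d × Fin d) (Fin d × Fin d) ℂ) :
    ofJamiolkowski J = (d : ℂ) • reshuffle (vecMap J) := by
  ext1 X
  ext b b'
  rw [LinearMap.smul_apply, Matrix.smul_apply, reshuffle_apply_apply]
  have : ∀ k a, vecMap J (Matrix.single b' a 1) b k = J (b, k) (b', a) :=
    fun k a => vecMap_single J (b, k) (b', a)
  simp [ofJamiolkowski, this, mul_comm]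

theorem vecMap_jamiolkowski (E : SuperOp d) :
    vecMap (jamiolkowski E) = (d : ℂ)⁻¹ • reshuffle E := by
  ext1 X
  ext b b'
  rw [LinearMap.smul_apply, Matrix.smul_apply, reshuffle_apply_apply]
  simp [vecMap, jamiolkowski, Fintype.sum_prod_type, Finset.mul_sum, mul_assoc]

theorem ofJamiolkowski_jamiolkowski (hd : d ≠ 0) (E : SuperOp d) :
    ofJamiolkowski (jamiolkowski E) = E := by
  have hd0 : (d : ℂ) ≠ 0 := by exact_mod_cast hd
  ext1 X
  conv_rhs => rw [Matrix.matrix_eq_sum_single X]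
  ext b b'
  have hs : ∀ i j, Matrix.single i j (X i j) = X i j • Matrix.single i j (1 : ℂ) := by
    simp [Matrix.smul_single]
  simp only [hs, map_sum, map_smul, Matrix.sum_apply, Matrix.smul_apply, smul_eq_mul]
  simp only [ofJamiolkowski, jamiolkowski, LinearMap.coe_mk, AddHom.coe_mk, Matrix.of_apply,
    Finset.mul_sum]
  refine Finset.sum_congr rfl fun a _ => Finset.sum_congr rfl fun a' _ => ?_
  field_simp

theorem IsCovariant.smul {G : Type*} [Group G] {U : G →* Matrix.unitaryGroup (Fin d) ℂ}
    {E : SuperOp d} (hE : IsCovariant U E) (c : ℂ) : IsCovariant U (c • E) := by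
  intro g X
  simp [hE g X]

theorem IsCovariant.vecMap_jamiolkowski {G : Type*} [Group G]
    {U : G →* Matrix.unitaryGroup (Fin d) ℂ} {E : SuperOp d} (hE : IsCovariant U E) :
    IsCovariant U (vecMap (jamiolkowski E)) := by
  rw [CovariantChannel.vecMap_jamiolkowski]
  exact hE.reshuffle.smul _

theorem isCovariant_ofJamiolkowski {G : Type*} [Group G]
    {U : G →* Matrix.unitaryGroup (Fin d) ℂ} {J : Matrix (Fin d × Fin d) (Fin d × Fin d) ℂ}
    (hJ : IsCovariant U (vecMap J)) : IsCovariant U (ofJamiolkowski J) := by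
  rw [reshuffle_vecMap]
  exact hJ.reshuffle.smul _

end Reshuffle

end CovariantChannel

/-! ### Block projectors, positivity and adjoints. -/

namespace CovariantChannel

section Block

variable {d : ℕ}

theorem inner_vectorise (X Y : Op d) :
    inner ℂ (vectorise d X) (vectorise d Y) = (X.conjTranspose * Y).trace := by
  rw [PiLp.inner_apply, Fintype.sum_prod_type, Finset.sum_comm]
  simp [vectorise, Matrix.trace, Matrix.mul_apply, mul_comm]

theorem vectorise_injective : Function.Injective (vectorise d) := by
  intro X Y h
  ext i j
  exact congrArg (fun v : EuclideanSpace ℂ (Fin d × Fin d) => v (i, j)) h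

theorem vectorise_vecMap_blockProjection (W : Submodule ℂ (Op d)) (X : Op d) :
    vectorise d (vecMap (blockProjection W) X) =
      (W.map (vectorise d)).starProjection (vectorise d X) := by
  have h : vectorise d X = ∑ q, X q.1 q.2 • EuclideanSpace.single q (1 : ℂ) := by
    ext p
    simp [vectorise, Finset.sum_apply, Pi.single_apply]
  rw [h, map_sum]
  ext p
  simp [vectorise, vecMap, blockProjection, mul_comm]

theorem vecMap_blockProjection_mem (W : Submodule ℂ (Op d)) (X : Op d) :
    vecMap (blockProjection W) X ∈ W := by
  have h : (W.map (vectorise d)).starProjection (vectorise d X) ∈ W.map (vectorise d) :=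
    Submodule.starProjection_apply_mem _ _
  rw [← vectorise_vecMap_blockProjection] at h
  obtain ⟨Y, hY, hYX⟩ := h
  rwa [← vectorise_injective hYX]

theorem vecMap_blockProjection_of_mem {W : Submodule ℂ (Op d)} {X : Op d} (hX : X ∈ W) :
    vecMap (blockProjection W) X = X := by
  apply vectorise_injective
  rw [vectorise_vecMap_blockProjection, Submodule.starProjection_eq_self_iff]
  exact ⟨X, hX, rfl⟩

theorem trace_mul_sub_vecMap_blockProjection {W : Submodule ℂ (Op d)} {Y : Op d} (hY : Y ∈ W)
    (X : Op d) : (Y.conjTranspose * (X - vecMap (blockProjection W) X)).trace = 0 := by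
  rw [← inner_vectorise, map_sub, vectorise_vecMap_blockProjection]
  exact Submodule.inner_right_of_mem_orthogonal (Submodule.mem_map_of_mem hY)
    (Submodule.sub_starProjection_mem_orthogonal _)

theorem vecMap_blockProjection_eq {W : Submodule ℂ (Op d)} {X Z : Op d} (hZ : Z ∈ W)
    (h : ∀ Y ∈ W, (Y.conjTranspose * (X - Z)).trace = 0) : vecMap (blockProjection W) X = Z := by
  apply vectorise_injective
  rw [vectorise_vecMap_blockProjection]
  refine Submodule.eq_starProjection_of_mem_of_inner_eq_zero ⟨Z, hZ, rfl⟩ ?_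
  rintro _ ⟨Y, hY, rfl⟩
  rw [← map_sub, ← inner_conj_symm, inner_vectorise, h Y hY, map_zero]

/-- Conjugation is unitary for the Hilbert–Schmidt inner product, so the orthogonal projection onto
an invariant subspace commutes with it. -/
theorem isCovariant_vecMap_blockProjection {G : Type*} [Group G]
    {U : G →* Matrix.unitaryGroup (Fin d) ℂ} (W : Subrepresentation (conjRep U)) :
    IsCovariant U (vecMap (blockProjection W.toSubmodule)) := by
  intro g X
  refine vecMap_blockProjection_eq
    (W.apply_mem_toSubmodule g (vecMap_blockProjection_mem _ _)) fun Y hY => ?_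
  have hW' : (U g : Op d).conjTranspose * (U g : Op d) = 1 := (U g).2.1
  have h := trace_mul_sub_vecMap_blockProjection (W.apply_mem_toSubmodule g⁻¹ hY) X
  have hinv : (U g⁻¹ : Op d) = (U g : Op d).conjTranspose := by
    rw [map_inv]; rfl
  rw [conjRep_apply, hinv] at h
  rw [← map_sub, conjRep_apply, ← h]
  simp only [Matrix.conjTranspose_mul, Matrix.conjTranspose_conjTranspose, mul_assoc]
  rw [← mul_assoc, ← mul_assoc, Matrix.trace_mul_comm]
  simp only [mul_assoc]

theorem star_dotProduct_mulVec_vec (J : Matrix (Fin d × Fin d) (Fin d × Fin d) ℂ) (X : Op d) :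
    dotProduct (star fun p : Fin d × Fin d => X p.1 p.2)
      (J.mulVec fun p : Fin d × Fin d => X p.1 p.2) = (X.conjTranspose * vecMap J X).trace := by
  rw [← inner_vectorise, PiLp.inner_apply]
  simp [dotProduct, vectorise, vecMap, Matrix.mulVec, mul_comm]

theorem posSemidef_blockProjection (W : Submodule ℂ (Op d)) : (blockProjection W).PosSemidef := by
  have hsa : ∀ x y, inner ℂ ((W.map (vectorise d)).starProjection x) y =
      inner ℂ x ((W.map (vectorise d)).starProjection y) :=
    fun x y => Submodule.inner_starProjection_left_eq_right _ x y
  refine Matrix.PosSemidef.of_dotProduct_mulVec_nonneg ?_ fun v => ?_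
  · ext p q
    have h := hsa (EuclideanSpace.single p (1 : ℂ)) (EuclideanSpace.single q 1)
    rw [EuclideanSpace.inner_single_left, EuclideanSpace.inner_single_right] at h
    simpa [blockProjection] using h
  · have h := star_dotProduct_mulVec_vec (blockProjection W) (Matrix.of fun i j => v (i, j))
    simp only [Matrix.of_apply, Prod.mk.eta] at h
    rw [h, ← inner_vectorise, vectorise_vecMap_blockProjection, ← hsa,
      ← (W.map (vectorise d)).isIdempotentElem_starProjection.eq]
    simp only [mul_apply_eq_comp]
    rw [hsa, inner_self_eq_norm_sq_to_K]
    rw [← RCLike.ofReal_pow]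
    exact RCLike.ofReal_nonneg.2 (sq_nonneg _)

theorem trace_vecMap (J : Matrix (Fin d × Fin d) (Fin d × Fin d) ℂ) :
    LinearMap.trace ℂ (Op d) (vecMap J) = J.trace := by
  rw [LinearMap.trace_eq_matrix_trace ℂ (Matrix.stdBasis ℂ (Fin d) (Fin d)), Matrix.trace,
    Matrix.trace]
  refine Finset.sum_congr rfl fun p _ => ?_
  rw [Matrix.diag_apply, LinearMap.toMatrix_apply, Matrix.diag_apply, ← vecMap_single J p p,
    Matrix.stdBasis_eq_single]
  rfl

theorem trace_blockProjection (W : Submodule ℂ (Op d)) :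
    (blockProjection W).trace = Module.finrank ℂ W := by
  rw [← trace_vecMap]
  exact LinearMap.IsProj.trace
    ⟨vecMap_blockProjection_mem W, fun _ => vecMap_blockProjection_of_mem⟩

theorem trace_jamiolkowski_mul_kronecker (E : SuperOp d) (A B : Op d) :
    (jamiolkowski E * Matrix.kronecker A B).trace = (d : ℂ)⁻¹ * (E B.transpose * A).trace := by
  have h : E B.transpose = ∑ a, ∑ a', B a' a • E (Matrix.single a a' 1) := by
    conv_lhs => rw [Matrix.matrix_eq_sum_single B.transpose]
    simp only [map_sum, ← map_smul, Matrix.smul_single, Matrix.transpose_apply, smul_eq_mul,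
      mul_one]
  rw [h]
  simp only [Matrix.trace, Matrix.diag_apply, Matrix.mul_apply, Fintype.sum_prod_type,
    Matrix.kronecker, Matrix.kroneckerMap_apply, jamiolkowski, Matrix.of_apply, Matrix.sum_apply, Matrix.smul_apply,
    smul_eq_mul, Finset.sum_mul, Finset.mul_sum]
  refine Finset.sum_congr rfl fun b _ => ?_
  refine Finset.sum_congr rfl fun a _ => ?_
  rw [Finset.sum_comm]
  refine Finset.sum_congr rfl fun b' _ => ?_
  refine Finset.sum_congr rfl fun a' _ => ?_
  ring

/-- Positivity is tested on the square of D = K ⊗ 1 - 1 ⊗ Kᵀ, which annihilates |Ω⟩. By unitality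
and trace preservation the two square terms both give tr(K²), and the cross terms give -2 tr(E(K)K).
-/
theorem trace_map_mul_self_le {E : SuperOp d} (hd : d ≠ 0) (hJ : (jamiolkowski E).PosSemidef)
    (h1 : E 1 = 1) (htr : ∀ X, (E X).trace = X.trace) {K : Op d} (hK : K.IsHermitian) :
    (E K * K).trace.re ≤ (K * K).trace.re := by
  set D := Matrix.kronecker K (1 : Op d) - Matrix.kronecker (1 : Op d) K.transpose with hD
  have hDD : D * D = Matrix.kronecker (K * K) (1 : Op d) +
      Matrix.kronecker (1 : Op d) (K.transpose * K.transpose) -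
        (Matrix.kronecker K K.transpose + Matrix.kronecker K K.transpose) := by
    rw [hD, sub_mul, mul_sub, mul_sub]
    simp only [Matrix.kronecker, ← Matrix.mul_kronecker_mul, mul_one, one_mul]
    abel
  have hDh : D.conjTranspose = D := by
    rw [hD, Matrix.conjTranspose_sub]
    simp only [Matrix.kronecker, Matrix.conjTranspose_kronecker, Matrix.conjTranspose_one,
      hK.eq, hK.transpose.eq]
  have h := (hJ.mul_mul_conjTranspose_same D).trace_nonneg
  rw [hDh, Matrix.trace_mul_comm, ← mul_assoc, Matrix.trace_mul_comm, hDD, mul_sub, mul_add,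
    mul_add, Matrix.trace_sub, Matrix.trace_add, Matrix.trace_add] at h
  simp only [trace_jamiolkowski_mul_kronecker, Matrix.transpose_one, Matrix.transpose_mul,
    Matrix.transpose_transpose, h1, mul_one, one_mul, htr, ← mul_add, ← mul_sub] at h
  have hd' : (0 : ℂ) < d := by exact_mod_cast Nat.pos_of_ne_zero hd
  have h2 := mul_nonneg hd'.le h
  rw [← mul_assoc, mul_inv_cancel₀ hd'.ne', one_mul, Complex.nonneg_iff] at h2
  have h3 := h2.1
  simp only [Complex.sub_re, Complex.add_re] at h3
  linarith

theorem posSemidef_jamiolkowski {E : SuperOp d} (hE : IsChannel E) :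
    (jamiolkowski E).PosSemidef := by
  -- The unnormalised |Ω⟩. The ampliation puts the ancilla first and `jamiolkowski` puts it second,
  -- hence the swap below.
  let w : Fin d × Fin d → ℂ := fun p => if p.1 = p.2 then 1 else 0
  have h := hE.completelyPositive d _ (Matrix.posSemidef_vecMulVec_self_star w)
  have hs : ∀ a a', (Matrix.of fun i j => Matrix.vecMulVec w (star w) (a, i) (a', j)) =
      Matrix.single a a' (1 : ℂ) := by
    intro a a'
    ext i j
    simp [w, Matrix.vecMulVec_apply, Matrix.single_apply, ← ite_and, and_comm]
  have hJ : jamiolkowski E = (d : ℂ)⁻¹ •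
      (ampliation E d (Matrix.vecMulVec w (star w))).submatrix Prod.swap Prod.swap := by
    ext p q
    simp [jamiolkowski, ampliation, hs]
  rw [hJ]
  refine (h.submatrix _).smul ?_
  rw [← Complex.ofReal_natCast, ← Complex.ofReal_inv]
  exact Complex.zero_le_real.2 (by positivity)

theorem conjTranspose_map_single (hd : d ≠ 0) {E : SuperOp d}
    (hJ : (jamiolkowski E).IsHermitian) (i j : Fin d) :
    (E (Matrix.single i j 1)).conjTranspose = E (Matrix.single j i 1) := by
  have hd0 : (d : ℂ) ≠ 0 := by exact_mod_cast hd
  ext b b'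
  have h := hJ.apply (b, j) (b', i)
  simpa [jamiolkowski, hd0] using h

theorem isHermitian_adjoint (hd : d ≠ 0) {E : SuperOp d}
    (hJ : (jamiolkowski E).IsHermitian) {K : Op d} (hK : K.IsHermitian) :
    (adjoint E K).IsHermitian := by
  ext i j
  simp only [Matrix.conjTranspose_apply, adjoint, LinearMap.coe_mk, AddHom.coe_mk,
    Matrix.of_apply]
  rw [← Matrix.trace_conjTranspose, Matrix.conjTranspose_mul, hK.eq,
    conjTranspose_map_single hd hJ, Matrix.trace_mul_comm]

theorem eq_of_trace_mul_eq {A B : Op d} (h : ∀ X : Op d, (X * A).trace = (X * B).trace) :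
    A = B := by
  ext i j
  simpa [Matrix.trace_single_mul] using h (Matrix.single j i 1)

theorem IsCovariant.adjoint {G : Type*} [Group G] {U : G →* Matrix.unitaryGroup (Fin d) ℂ}
    {E : SuperOp d} (hE : IsCovariant U E) : IsCovariant U (adjoint E) := by
  have hmove : ∀ g (X Y : Op d), (X * conjRep U g Y).trace = (conjRep U g⁻¹ X * Y).trace := by
    intro g X Y
    have hinv : (U g⁻¹ : Op d) = (U g : Op d).conjTranspose := by
      rw [map_inv]; rfl
    rw [conjRep_apply, conjRep_apply, hinv, Matrix.conjTranspose_conjTranspose,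
      ← mul_assoc, Matrix.trace_mul_comm]
    simp only [mul_assoc]
  intro g Y
  refine eq_of_trace_mul_eq fun X => ?_
  rw [← trace_mul_adjoint, hmove, hmove, ← trace_mul_adjoint, hE]

end Block

/-! ### Isolated extremal channels and the convex decomposition. -/

section Components

variable {G : Type*} [Group G] {d : ℕ} {U : G →* Matrix.unitaryGroup (Fin d) ℂ}

theorem isCovariant_blockChannel (W : Subrepresentation (conjRep U)) :
    IsCovariant U (blockChannel W.toSubmodule) := by
  refine isCovariant_ofJamiolkowski ?_
  have : vecMap ((Module.finrank ℂ W.toSubmodule : ℂ)⁻¹ • blockProjection W.toSubmodule) =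
      (Module.finrank ℂ W.toSubmodule : ℂ)⁻¹ • vecMap (blockProjection W.toSubmodule) := by
    ext1 X
    ext b a
    simp [vecMap, Finset.mul_sum, mul_assoc]
  rw [this]
  exact (isCovariant_vecMap_blockProjection W).smul _

theorem posSemidef_jamiolkowski_blockChannel (W : Submodule ℂ (Op d)) :
    (jamiolkowski (blockChannel W)).PosSemidef := by
  rw [blockChannel, jamiolkowski_ofJamiolkowski]
  refine (posSemidef_blockProjection W).smul ?_
  rw [← Complex.ofReal_natCast, ← Complex.ofReal_inv]
  exact Complex.zero_le_real.2 (by positivity)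

theorem trace_map_one (hd : d ≠ 0) (E : SuperOp d) : (E 1).trace = d * (jamiolkowski E).trace := by
  have hd0 : (d : ℂ) ≠ 0 := by exact_mod_cast hd
  have h := trace_jamiolkowski_mul_kronecker E 1 1
  simp only [Matrix.kronecker, Matrix.one_kronecker_one, mul_one, Matrix.transpose_one] at h
  rw [h, ← mul_assoc, mul_inv_cancel₀ hd0, one_mul]

variable {ι : Type*} [Fintype ι] [DecidableEq ι] {V : ι → Subrepresentation (conjRep U)}

namespace IsMultiplicityFreeDecomposition

omit [Fintype ι] in
theorem finrank_ne_zero (hV : IsMultiplicityFreeDecomposition U V) (l : ι) :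
    (Module.finrank ℂ (V l).toSubmodule : ℂ) ≠ 0 := by
  obtain ⟨X, hX, hX0⟩ := hV.exists_mem_ne_zero l
  have : Nontrivial (V l).toSubmodule :=
    ⟨⟨X, hX⟩, 0, fun h => hX0 (congrArg Subtype.val h)⟩
  exact_mod_cast (Module.finrank_pos (R := ℂ) (M := (V l).toSubmodule)).ne'

/-- By covariance a single scalar governs both claims; it is 1 because the Jamiołkowski operator has
unit trace. -/
theorem blockChannel_map_one_trace (hV : IsMultiplicityFreeDecomposition U V) (hd : d ≠ 0)
    (l : ι) : blockChannel (V l).toSubmodule 1 = 1 ∧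
      ∀ X, (blockChannel (V l).toSubmodule X).trace = X.trace := by
  have hd0 : (d : ℂ) ≠ 0 := by exact_mod_cast hd
  obtain ⟨c, h1, ht⟩ := hV.exists_map_one_trace hd (isCovariant_blockChannel (V l))
  have h := trace_map_one hd (blockChannel (V l).toSubmodule)
  rw [h1, blockChannel, jamiolkowski_ofJamiolkowski, Matrix.trace_smul, Matrix.trace_smul,
    trace_blockProjection, smul_eq_mul, smul_eq_mul, inv_mul_cancel₀ (hV.finrank_ne_zero l),
    Matrix.trace_one, Fintype.card_fin, mul_one] at h
  have hc : c = 1 := by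
    apply mul_right_cancel₀ hd0
    rw [h, one_mul]
  subst hc
  exact ⟨by simpa using h1, by simpa using ht⟩

/-- Distinct components are orthogonal, although the decomposition is only assumed direct: by Schur
the projection onto one acts on the other as a scalar, so the image lies in their intersection. -/
theorem vecMap_blockProjection_of_mem_of_ne (hV : IsMultiplicityFreeDecomposition U V) {l m : ι}
    (hlm : l ≠ m) {X : Op d} (hX : X ∈ (V m).toSubmodule) :
    vecMap (blockProjection (V l).toSubmodule) X = 0 := by
  obtain ⟨c, hc⟩ := hV.exists_scalar (isCovariant_vecMap_blockProjection (V l))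
  refine hV.eq_zero_of_mem_of_mem hlm (vecMap_blockProjection_mem _ _) ?_
  rw [hc m X hX]
  exact Submodule.smul_mem _ _ hX

/-- A covariant channel is a convex combination of the isolated extremal ones. -/
theorem exists_convex_combination (hV : IsMultiplicityFreeDecomposition U V) (hd : d ≠ 0)
    {E : SuperOp d} (hE : IsChannel E) (hcov : IsCovariant U E) :
    ∃ p : ι → ℝ, (∀ l, 0 ≤ p l) ∧ ∑ l, p l = 1 ∧
      (∀ l, ∀ X ∈ (V l).toSubmodule, vecMap (jamiolkowski E) X =
        ((p l : ℂ) / Module.finrank ℂ (V l).toSubmodule) • X) ∧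
      ∀ X, E X = ∑ l, (p l : ℂ) • blockChannel (V l).toSubmodule X := by
  have hd0 : (d : ℂ) ≠ 0 := by exact_mod_cast hd
  obtain ⟨t, ht⟩ := hV.exists_scalar hcov.vecMap_jamiolkowski
  have hnn : ∀ l, 0 ≤ t l := by
    intro l
    obtain ⟨X, hX, hX0⟩ := hV.exists_mem_ne_zero l
    -- Tested on a vectorised eigenvector X, the quadratic form is t_l ‖X‖².
    have h := (posSemidef_jamiolkowski hE).dotProduct_mulVec_nonneg
      (fun p : Fin d × Fin d => X p.1 p.2)
    rw [star_dotProduct_mulVec_vec, ht l X hX, ← inner_vectorise, map_smul, inner_smul_right,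
      inner_self_eq_norm_sq_to_K] at h
    have hpos : (0 : ℝ) < ‖vectorise d X‖ ^ 2 := by
      have : vectorise d X ≠ 0 := fun h0 => hX0 (vectorise_injective (by rw [h0, map_zero]))
      positivity
    rw [← RCLike.ofReal_pow] at h
    obtain ⟨hr, hi⟩ := Complex.nonneg_iff.1 h
    rw [RCLike.ofReal_eq_complex_ofReal] at hr hi
    rw [Complex.re_mul_ofReal] at hr
    rw [Complex.im_mul_ofReal] at hi
    exact Complex.nonneg_iff.2 ⟨nonneg_of_mul_nonneg_left hr hpos,
      ((mul_eq_zero.1 hi.symm).resolve_right hpos.ne').symm⟩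
  have hre : ∀ l, ((t l).re : ℂ) = t l := fun l => by
    have := Complex.nonneg_iff.1 (hnn l)
    exact Complex.ext (by simp) (by simpa using this.2)
  -- The dimension compensates the normalisation 1/dim in `blockChannel`.
  let p : ι → ℝ := fun l => (t l).re * Module.finrank ℂ (V l).toSubmodule
  have hp : ∀ l, (p l : ℂ) / Module.finrank ℂ (V l).toSubmodule = t l := by
    intro l
    simp only [p, Complex.ofReal_mul, Complex.ofReal_natCast, hre]
    exact mul_div_cancel_right₀ _ (hV.finrank_ne_zero l)
  have hJ : jamiolkowski E = ∑ l, t l • blockProjection (V l).toSubmodule := by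
    apply vecMap_injective
    refine hV.ext_of_mem fun m X hX => ?_
    have hlin : vecMap (∑ l, t l • blockProjection (V l).toSubmodule) X =
        ∑ l, t l • vecMap (blockProjection (V l).toSubmodule) X := by
      ext b a
      simp only [vecMap, LinearMap.coe_mk, AddHom.coe_mk, Matrix.of_apply, Matrix.sum_apply,
        Matrix.smul_apply, smul_eq_mul, Finset.sum_mul, Finset.mul_sum, mul_assoc]
      exact Finset.sum_comm
    rw [ht m X hX, hlin, Finset.sum_eq_single m, vecMap_blockProjection_of_mem hX]
    · intro l _ hl
      rw [hV.vecMap_blockProjection_of_mem_of_ne hl hX, smul_zero]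
    · simp
  have hsum : ∀ X, E X = ∑ l, (p l : ℂ) • blockChannel (V l).toSubmodule X := by
    intro X
    conv_lhs => rw [← ofJamiolkowski_jamiolkowski hd E, hJ]
    ext b b'
    simp only [blockChannel, ofJamiolkowski, LinearMap.coe_mk, AddHom.coe_mk, Matrix.of_apply,
      Matrix.sum_apply, Matrix.smul_apply, smul_eq_mul, ← hp]
    have hcomm : ∀ F : Fin d → Fin d → ι → ℂ, ∑ a, ∑ a', ∑ l, F a a' l =
        ∑ l, ∑ a, ∑ a', F a a' l := by
      intro F
      rw [Finset.sum_comm]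
      refine (Finset.sum_congr rfl fun a _ => Finset.sum_comm).trans ?_
      rw [Finset.sum_comm]
      exact Finset.sum_congr rfl fun l _ => Finset.sum_comm
    simp only [Finset.mul_sum]
    rw [hcomm]
    refine Finset.sum_congr rfl fun l _ => Finset.sum_congr rfl fun a _ =>
      Finset.sum_congr rfl fun a' _ => ?_
    ring
  refine ⟨p, fun l => mul_nonneg (Complex.nonneg_iff.1 (hnn l)).1 (Nat.cast_nonneg _), ?_, ?_,
    hsum⟩
  · have h := hE.tracePreserving 1
    rw [hsum] at h
    simp only [Matrix.trace_sum, Matrix.trace_smul, (hV.blockChannel_map_one_trace hd _).2,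
      smul_eq_mul, Matrix.trace_one, Fintype.card_fin, ← Finset.sum_mul] at h
    have h2 : ∑ l, (p l : ℂ) = 1 := mul_right_cancel₀ hd0 (by rw [h, one_mul])
    exact_mod_cast h2
  · intro l X hX
    rw [hp, ht l X hX]

end IsMultiplicityFreeDecomposition

end Components

end CovariantChannel

/-! ### Deviation and unitarity as closed formulas. -/

namespace CovariantChannel

open MeasureTheory

theorem isHermitian_pureState {d : ℕ} (ψ : Metric.sphere (0 : EuclideanSpace ℂ (Fin d)) 1) :
    (pureState ψ).IsHermitian := by
  ext i j
  simp [pureState, mul_comm]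

theorem trace_pureState {d : ℕ} (ψ : Metric.sphere (0 : EuclideanSpace ℂ (Fin d)) 1) :
    (pureState ψ).trace = 1 := by
  rw [← sum_mul_star_eq_one ψ]
  rfl

/-- The mean square expectation of a traceless observable in a random pure state. -/
theorem integral_norm_trace_pureState_mul_sq {d : ℕ} (hd : d ≠ 0) {K : Op d}
    (hK : K.IsHermitian) (htr : K.trace = 0) :
    ∫ ψ, ‖(pureState ψ * K).trace‖ ^ 2 ∂(haarState d) = (K ^ 2).trace.re / (d * (d + 1)) := by
  let φ : Op d →ₗ[ℂ] ℂ := Matrix.traceLinearMap (Fin d) ℂ ℂ ∘ₗ LinearMap.mulRight ℂ K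
  have hφ : ∀ X, φ X = (X * K).trace := fun _ => rfl
  have h := integral_bilinear_pureState hd ((LinearMap.mul ℂ ℂ).compl₁₂ φ φ)
  simp only [LinearMap.compl₁₂_apply, LinearMap.mul_apply', hφ, one_mul, htr, mul_zero, zero_add,
    Matrix.trace_single_mul, one_smul] at h
  have hsq : ∑ i, ∑ j, K j i * K i j = (K ^ 2).trace := by
    simp only [sq, Matrix.trace, Matrix.diag_apply, Matrix.mul_apply, mul_comm]
  have hnorm : ∀ ψ : Metric.sphere (0 : EuclideanSpace ℂ (Fin d)) 1,
      (pureState ψ * K).trace * (pureState ψ * K).trace =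
        ((‖(pureState ψ * K).trace‖ ^ 2 : ℝ) : ℂ) := by
    intro ψ
    have hs : star (pureState ψ * K).trace = (pureState ψ * K).trace := by
      rw [← Matrix.trace_conjTranspose, Matrix.conjTranspose_mul, hK.eq,
        (isHermitian_pureState ψ).eq, Matrix.trace_mul_comm]
    rw [← Complex.normSq_eq_norm_sq, ← Complex.mul_conj, ← RCLike.star_def, hs]
  simp only [hnorm, hsq] at h
  rw [integral_complex_ofReal] at h
  have h2 := congrArg Complex.re h
  rw [show ((d : ℂ) * (d + 1)) = ((d * (d + 1) : ℝ) : ℂ) by push_cast; rfl,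
    Complex.div_ofReal_re] at h2
  exact h2

theorem avgDeviation_eq {d n : ℕ} (hd : d ≠ 0) {J : Fin n → Op d} (hJ : ∀ k, (J k).IsHermitian)
    (hJtr : ∀ k, (J k).trace = 0) {E : SuperOp d} {F : ℝ}
    (hF : ∀ k X, (E X * J k).trace = F * (X * J k).trace) :
    avgDeviation J E = (1 - F) ^ 2 * ((∑ k, ((J k) ^ 2).trace.re) / (d * (d + 1))) := by
  rw [avgDeviation, Finset.sum_div, Finset.mul_sum]
  refine Finset.sum_congr rfl fun k _ => ?_
  rw [← integral_norm_trace_pureState_mul_sq hd (hJ k) (hJtr k), ← integral_const_mul]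
  congr 1
  ext ψ
  rw [Matrix.trace_sub, hF,
    show (F : ℂ) * (pureState ψ * J k).trace - (pureState ψ * J k).trace =
      ((F - 1 : ℝ) : ℂ) * (pureState ψ * J k).trace by push_cast; ring, norm_mul,
    Complex.norm_real, mul_pow, Real.norm_eq_abs, sq_abs]
  ring

/-- The squared Hilbert–Schmidt norm of a superoperator. -/
noncomputable def hilbertSchmidtSq {d : ℕ} (E : SuperOp d) : ℝ :=
  ∑ i, ∑ j, ∑ b, ∑ b', ‖E (Matrix.single i j 1) b b'‖ ^ 2

theorem unitarity_eq {d : ℕ} (hd : 2 ≤ d) {E : SuperOp d} (hJ : (jamiolkowski E).IsHermitian)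
    (h1 : E 1 = 1) (htr : ∀ X, (E X).trace = X.trace) :
    unitarity E = (hilbertSchmidtSq E - 1) / ((d : ℝ) ^ 2 - 1) := by
  have hd' : d ≠ 0 := by omega
  have hdR : (2 : ℝ) ≤ d := by exact_mod_cast hd
  have hd0 : (d : ℂ) ≠ 0 := by exact_mod_cast hd'
  have := isProbabilityMeasure_haarState hd'
  have h := integral_bilinear_pureState hd' (((LinearMap.mul ℂ (Op d)).compl₁₂ E E).compr₂
    (Matrix.traceLinearMap (Fin d) ℂ ℂ))
  simp only [LinearMap.compr₂_apply, LinearMap.compl₁₂_apply, LinearMap.mul_apply',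
    Matrix.traceLinearMap_apply, h1, mul_one, Matrix.trace_one, Fintype.card_fin] at h
  -- The flip term of the Haar average is the Hilbert–Schmidt norm, since E(|j⟩⟨i|) is the conjugate
  -- transpose of E(|i⟩⟨j|).
  have hN : ∑ i, ∑ j, (E (Matrix.single i j 1) * E (Matrix.single j i 1)).trace =
      (hilbertSchmidtSq E : ℂ) := by
    rw [hilbertSchmidtSq]
    push_cast
    refine Finset.sum_congr rfl fun i _ => Finset.sum_congr rfl fun j _ => ?_
    rw [← conjTranspose_map_single hd' hJ i j]
    simp only [Matrix.trace, Matrix.diag_apply, Matrix.mul_apply, Matrix.conjTranspose_apply]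
    refine Finset.sum_congr rfl fun b _ => Finset.sum_congr rfl fun b' _ => ?_
    rw [RCLike.star_def, Complex.mul_conj, Complex.normSq_eq_norm_sq]
    push_cast
    rfl
  rw [hN] at h
  have hexp : ∀ ψ : Metric.sphere (0 : EuclideanSpace ℂ (Fin d)) 1,
      ((E (pureState ψ - (d : ℂ)⁻¹ • (1 : Op d))) ^ 2).trace.re =
        (E (pureState ψ) * E (pureState ψ)).trace.re - (d : ℝ)⁻¹ := by
    intro ψ
    rw [map_sub, map_smul, h1, sq, sub_mul, mul_sub, mul_sub]
    simp only [Matrix.mul_smul, Matrix.smul_mul, mul_one, one_mul, Matrix.trace_sub,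
      Matrix.trace_smul, htr, trace_pureState, Matrix.trace_one, Fintype.card_fin, smul_eq_mul,
      inv_mul_cancel₀ hd0]
    rw [← Complex.ofReal_natCast, ← Complex.ofReal_inv]
    simp
  have hEc : Continuous fun ψ : Metric.sphere (0 : EuclideanSpace ℂ (Fin d)) 1 =>
      (E (pureState ψ) * E (pureState ψ)).trace := by
    have : Continuous fun ψ : Metric.sphere (0 : EuclideanSpace ℂ (Fin d)) 1 => E (pureState ψ) :=
      (LinearMap.continuous_of_finiteDimensional E).comp continuous_pureState
    exact (this.mul this).matrix_trace
  rw [unitarity]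
  simp only [hexp]
  rw [integral_sub (by exact integrable_haarState hd' (Complex.continuous_re.comp hEc))
    (integrable_const _), integral_const, probReal_univ, one_smul]
  have hre : ∫ ψ, (E (pureState ψ) * E (pureState ψ)).trace.re ∂(haarState d) =
      (∫ ψ, (E (pureState ψ) * E (pureState ψ)).trace ∂(haarState d)).re :=
    integral_re (integrable_haarState hd' hEc)
  rw [hre, h, show ((d : ℂ) + hilbertSchmidtSq E) / (d * (d + 1)) =
    (((d + hilbertSchmidtSq E) / (d * (d + 1)) : ℝ) : ℂ) by push_cast; rfl, Complex.ofReal_re]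
  have e1 : (d : ℝ) ≠ 0 := by positivity
  have e2 : (d : ℝ) - 1 ≠ 0 := by linarith
  have e3 : (d : ℝ) + 1 ≠ 0 := by positivity
  rw [show (d : ℝ) ^ 2 - 1 = (d - 1) * (d + 1) by ring]
  field_simp
  ring

/-- The eigenvalue equation at |Ω⟩ says that for each b the d entries ⟨b|E(|b⟩⟨b'|)|b'⟩ sum to dt.
Cauchy–Schwarz bounds their square sum below by dt², and there are d choices of b. -/
theorem sq_le_hilbertSchmidtSq {d : ℕ} (hd : d ≠ 0) {E : SuperOp d} {t : ℝ}
    (ht : vecMap (jamiolkowski E) 1 = (t : ℂ) • 1) : (d * t) ^ 2 ≤ hilbertSchmidtSq E := by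
  have hd0 : (d : ℂ) ≠ 0 := by exact_mod_cast hd
  have hdR : (0 : ℝ) < d := by exact_mod_cast Nat.pos_of_ne_zero hd
  have hb : ∀ b, ∑ b', E (Matrix.single b b' 1) b b' = d * t := by
    intro b
    have h := congrFun (congrFun ht b) b
    simp only [vecMap, jamiolkowski, LinearMap.coe_mk, AddHom.coe_mk, Matrix.of_apply,
      Fintype.sum_prod_type, Matrix.one_apply, mul_ite, mul_one, mul_zero, Finset.sum_ite_eq,
      Finset.mem_univ, if_true, Matrix.smul_apply, smul_eq_mul, ← Finset.mul_sum] at h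
    rw [← h, ← mul_assoc]
    field_simp
  have hb' : ∀ b, d * t ^ 2 ≤ ∑ b', ‖E (Matrix.single b b' 1) b b'‖ ^ 2 := by
    intro b
    have h1 := sq_sum_le_card_mul_sum_sq (s := Finset.univ)
      (f := fun b' => ‖E (Matrix.single b b' 1) b b'‖)
    have h2 : |d * t| ≤ ∑ b', ‖E (Matrix.single b b' 1) b b'‖ := by
      have := norm_sum_le Finset.univ fun b' => E (Matrix.single b b' 1) b b'
      rw [hb, show (d : ℂ) * t = ((d * t : ℝ) : ℂ) by push_cast; rfl, Complex.norm_real] at this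
      exact this
    have h3 : (d * t) ^ 2 ≤ (∑ b', ‖E (Matrix.single b b' 1) b b'‖) ^ 2 := by
      rw [← sq_abs]
      exact pow_le_pow_left₀ (abs_nonneg _) h2 2
    rw [Finset.card_univ, Fintype.card_fin] at h1
    refine le_of_mul_le_mul_left ?_ hdR
    calc d * (d * t ^ 2) = (d * t) ^ 2 := by ring
      _ ≤ _ := h3.trans h1
  calc (d * t) ^ 2 = ∑ _b : Fin d, d * t ^ 2 := by
        rw [Finset.sum_const, Finset.card_univ, Fintype.card_fin, nsmul_eq_mul]; ring
    _ ≤ ∑ b, ∑ b', ‖E (Matrix.single b b' 1) b b'‖ ^ 2 := Finset.sum_le_sum fun b _ => hb' b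
    _ ≤ hilbertSchmidtSq E := by
        refine Finset.sum_le_sum fun i _ => Finset.sum_le_sum fun j _ => ?_
        refine le_trans ?_ (Finset.single_le_sum
          (f := fun b => ∑ b', ‖E (Matrix.single i j 1) b b'‖ ^ 2) (fun b _ => by positivity)
          (Finset.mem_univ i))
        exact Finset.single_le_sum (f := fun b' => ‖E (Matrix.single i j 1) i b'‖ ^ 2)
          (fun b _ => by positivity) (Finset.mem_univ j)

theorem one_sub_unitarity_le {d : ℕ} (hd : 2 ≤ d) {E : SuperOp d}
    (hJ : (jamiolkowski E).IsHermitian) (h1 : E 1 = 1) (htr : ∀ X, (E X).trace = X.trace)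
    {t : ℝ} (ht : vecMap (jamiolkowski E) 1 = (t : ℂ) • 1) :
    (1 - unitarity E) * ((d : ℝ) ^ 2 - 1) ≤ 2 * d ^ 2 * (1 - t) := by
  have hdR : (2 : ℝ) ≤ d := by exact_mod_cast hd
  have hpos : (0 : ℝ) < (d : ℝ) ^ 2 - 1 := by nlinarith
  have h := sq_le_hilbertSchmidtSq (by omega) ht
  rw [unitarity_eq hd hJ h1 htr, sub_mul, div_mul_cancel₀ _ hpos.ne']
  -- The slack in 1 - t² ≤ 2(1 - t) is (1 - t)².
  nlinarith [mul_nonneg (sq_nonneg (d : ℝ)) (sq_nonneg (1 - t))]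

theorem minGap_le {G : Type*} [Group G] {d : ℕ} {U : G →* Matrix.unitaryGroup (Fin d) ℂ}
    {ι : Type*} {V : ι → Subrepresentation (conjRep U)} (f : ι → ℝ) {l : ι}
    (hl : ¬ (V l).toRepresentation.IsTrivial) : minGap U V f ≤ |1 - f l| :=
  ciInf_le ⟨0, by rintro _ ⟨m, rfl⟩; exact abs_nonneg _⟩
    (⟨l, hl⟩ : {l : ι // ¬ (V l).toRepresentation.IsTrivial})

theorem minGap_nonneg {G : Type*} [Group G] {d : ℕ} (U : G →* Matrix.unitaryGroup (Fin d) ℂ)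
    {ι : Type*} (V : ι → Subrepresentation (conjRep U)) (f : ι → ℝ) : 0 ≤ minGap U V f :=
  Real.iInf_nonneg fun _ => abs_nonneg _

theorem trace_sq_pos {d : ℕ} {K : Op d} (hK : K.IsHermitian) (hK0 : K ≠ 0) :
    0 < (K * K).trace.re := by
  have h : (K * K).trace = ((‖vectorise d K‖ ^ 2 : ℝ) : ℂ) := by
    have := inner_vectorise K K
    rw [hK.eq, inner_self_eq_norm_sq_to_K] at this
    rw [← this]
    push_cast
    rfl
  have : vectorise d K ≠ 0 := fun h0 => hK0 (vectorise_injective (by rw [h0, map_zero]))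
  rw [h, Complex.ofReal_re]
  positivity

theorem trace_sq_nonneg {d : ℕ} {K : Op d} (hK : K.IsHermitian) : 0 ≤ (K ^ 2).trace.re := by
  by_cases h : K = 0
  · simp [h]
  · rw [sq]
    exact (trace_sq_pos hK h).le

/-! ### The trade-off inequality and the existence of the coefficients. -/

section Main

variable {G : Type*} [Group G] {d n : ℕ} {U : G →* Matrix.unitaryGroup (Fin d) ℂ}
  {J : Fin n → Op d} {ι : Type*} [Fintype ι] [DecidableEq ι]
  {V : ι → Subrepresentation (conjRep U)}

namespace IsMultiplicityFreeDecomposition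

/-- An eigenvalue of the adjoint of an isolated extremal channel at a Hermitian operator is at
most one. -/
theorem eigenvalue_le_one (hV : IsMultiplicityFreeDecomposition U V) (hd : d ≠ 0) {K : Op d}
    (hK : K.IsHermitian) (hK0 : K ≠ 0) {l : ι} {f : ℝ}
    (hf : adjoint (blockChannel (V l).toSubmodule) K = (f : ℂ) • K) : f ≤ 1 := by
  obtain ⟨h1, htr⟩ := hV.blockChannel_map_one_trace hd l
  have h := trace_map_mul_self_le hd (posSemidef_jamiolkowski_blockChannel _) h1 htr hK
  rw [trace_mul_adjoint, hf, Matrix.mul_smul, Matrix.trace_smul, smul_eq_mul,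
    Complex.re_ofReal_mul] at h
  have := trace_sq_pos hK hK0
  by_contra! hlt
  nlinarith

/-- The Schur scalar of the adjoint on the common component serves all generators at once; it is
real because the adjoint maps Hermitian operators to Hermitian ones. -/
theorem exists_eigenvalues (hV : IsMultiplicityFreeDecomposition U V) (hd : d ≠ 0)
    (hJ : ∀ k, (J k).IsHermitian) {m : ι} (hm : ∀ k, J k ∈ (V m).toSubmodule) :
    ∃ f : ι → ℝ, ∀ l k, adjoint (blockChannel (V l).toSubmodule) (J k) = (f l : ℂ) • J k := by
  have hex : ∀ l, ∃ f : ℝ, ∀ k,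
      adjoint (blockChannel (V l).toSubmodule) (J k) = (f : ℂ) • J k := by
    intro l
    obtain ⟨c, hc⟩ := hV.exists_scalar (isCovariant_blockChannel (V l)).adjoint
    refine ⟨(c m).re, fun k => ?_⟩
    by_cases hJ0 : J k = 0
    · simp [hJ0]
    · have hH := isHermitian_adjoint hd (posSemidef_jamiolkowski_blockChannel
        (V l).toSubmodule).isHermitian (hJ k)
      rw [hc m _ (hm k)] at hH ⊢
      have h2 := hH.eq
      rw [Matrix.conjTranspose_smul, (hJ k).eq] at h2
      have h3 : star (c m) = c m := smul_left_injective ℂ hJ0 h2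
      rw [Complex.conj_eq_iff_re.1 h3]
  choose f hf using hex
  exact ⟨f, hf⟩

/-- The trade-off between the deviation from conservation laws and the unitarity. -/
theorem sqrt_avgDeviation_ge (hV : IsMultiplicityFreeDecomposition U V) (hd : 2 ≤ d)
    (hJ : ∀ k, (J k).IsHermitian) (hJtr : ∀ k, (J k).trace = 0) {f : ι → ℝ}
    (hf : ∀ l k, adjoint (blockChannel (V l).toSubmodule) (J k) = (f l : ℂ) • J k)
    {E : SuperOp d} (hE : IsChannel E) (hcov : IsCovariant U E) :
    minGap U V f * genNorm J * (1 - unitarity E) *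
      (((d : ℝ) - 1) * ((d : ℝ) + 1) ^ (1 / 2 : ℝ) / (2 * (d : ℝ) ^ (5 / 2 : ℝ))) ≤
        Real.sqrt (avgDeviation J E) := by
  have hd' : d ≠ 0 := by omega
  have hdR : (2 : ℝ) ≤ d := by exact_mod_cast hd
  have hg0 : 0 ≤ genNorm J := Real.sqrt_nonneg _
  -- With all generators zero, `f` is arbitrary and may exceed 1, but the left-hand side vanishes.
  by_cases hJ0 : ∀ k, J k = 0
  · have : genNorm J = 0 := by simp [genNorm, hJ0]
    rw [this, mul_zero, zero_mul, zero_mul]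
    exact Real.sqrt_nonneg _
  push Not at hJ0
  obtain ⟨k₀, hk₀⟩ := hJ0
  have hf1 : ∀ l, f l ≤ 1 := fun l => hV.eigenvalue_le_one hd' (hJ k₀) hk₀ (hf l k₀)
  obtain ⟨p, hp0, hp1, hpJ, hpE⟩ := hV.exists_convex_combination hd' hE hcov
  obtain ⟨l₀, h1mem, h1span, hne⟩ := hV.exists_trivial_component hd'
  have hfin : Module.finrank ℂ (V l₀).toSubmodule = 1 := by
    have : NeZero d := ⟨hd'⟩
    refine finrank_eq_one (⟨1, h1mem⟩ : (V l₀).toSubmodule) ?_ ?_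
    · intro h
      exact one_ne_zero (congrArg Subtype.val h)
    · rintro ⟨X, hX⟩
      obtain ⟨c, rfl⟩ := h1span X hX
      exact ⟨c, rfl⟩
  have ht : vecMap (jamiolkowski E) 1 = (p l₀ : ℂ) • 1 := by
    rw [hpJ l₀ 1 h1mem, hfin, Nat.cast_one, div_one]
  have hple : p l₀ ≤ 1 := by
    rw [← hp1]
    exact Finset.single_le_sum (fun l _ => hp0 l) (Finset.mem_univ l₀)
  have hE1 : E 1 = 1 := by
    rw [hpE]
    simp only [(hV.blockChannel_map_one_trace hd' _).1, ← Finset.sum_smul]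
    rw [← Complex.ofReal_sum, hp1, Complex.ofReal_one, one_smul]
  have hu := one_sub_unitarity_le hd (posSemidef_jamiolkowski hE).isHermitian hE1
    hE.tracePreserving ht
  set F : ℝ := ∑ l, p l * f l with hFdef
  have hF : ∀ k X, (E X * J k).trace = F * (X * J k).trace := by
    intro k X
    rw [hpE, Finset.sum_mul, Matrix.trace_sum, hFdef, Complex.ofReal_sum, Finset.sum_mul]
    refine Finset.sum_congr rfl fun l _ => ?_
    rw [Matrix.smul_mul, Matrix.trace_smul, trace_mul_adjoint, hf, Matrix.mul_smul,
      Matrix.trace_smul, smul_eq_mul, smul_eq_mul, Complex.ofReal_mul, mul_assoc]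
  set K := minGap U V f
  have hK0 : 0 ≤ K := minGap_nonneg U V f
  -- In 1 - F = ∑ p_l (1 - f(l)) every term is nonnegative. The scalar component is dropped, and
  -- every other component is nontrivial, so its gap is at least K.
  have hgap : K * (1 - p l₀) ≤ 1 - F := by
    have h1 : 1 - F = ∑ l, p l * (1 - f l) := by
      simp only [mul_sub, mul_one, Finset.sum_sub_distrib, hp1, hFdef]
    have h2 : K * (1 - p l₀) = ∑ l ∈ Finset.univ.erase l₀, p l * K := by
      rw [← Finset.sum_mul, Finset.sum_erase_eq_sub (Finset.mem_univ _), hp1, mul_comm]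
    rw [h1, h2, ← Finset.add_sum_erase _ _ (Finset.mem_univ l₀)]
    refine le_trans (Finset.sum_le_sum fun l hl => ?_)
      (le_add_of_nonneg_left (mul_nonneg (hp0 _) (sub_nonneg.2 (hf1 _))))
    refine mul_le_mul_of_nonneg_left ?_ (hp0 l)
    rw [← abs_of_nonneg (sub_nonneg.2 (hf1 l))]
    exact minGap_le f (hne l (Finset.ne_of_mem_erase hl)).2
  have hF1 : 0 ≤ 1 - F := le_trans (mul_nonneg hK0 (by linarith)) hgap
  have hsum : 0 ≤ ∑ k, ((J k) ^ 2).trace.re := Finset.sum_nonneg fun k _ => trace_sq_nonneg (hJ k)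
  have hdpos : (0 : ℝ) < d := by linarith
  have hs : 0 < Real.sqrt d := Real.sqrt_pos.2 hdpos
  have hq : 0 < Real.sqrt (d + 1) := Real.sqrt_pos.2 (by linarith)
  have hss : Real.sqrt d * Real.sqrt d = d := Real.mul_self_sqrt hdpos.le
  have hqq : Real.sqrt (d + 1) * Real.sqrt (d + 1) = d + 1 := Real.mul_self_sqrt (by linarith)
  have hΔ : Real.sqrt (avgDeviation J E) =
      (1 - F) * (genNorm J / (Real.sqrt d * Real.sqrt (d + 1))) := by
    rw [avgDeviation_eq hd' hJ hJtr hF, Real.sqrt_mul (sq_nonneg _), Real.sqrt_sq hF1,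
      Real.sqrt_div hsum, Real.sqrt_mul hdpos.le, genNorm]
  have hr : (d : ℝ) ^ (5 / 2 : ℝ) = d ^ 2 * Real.sqrt d := by
    rw [show (5 / 2 : ℝ) = 2 + 1 / 2 by norm_num, Real.rpow_add hdpos, Real.sqrt_eq_rpow,
      Real.rpow_two]
  -- The constant splits into the unitarity factor (d² - 1)/(2d²) and the deviation factor
  -- 1/√(d(d+1)).
  have hC : ((d : ℝ) - 1) * ((d : ℝ) + 1) ^ (1 / 2 : ℝ) / (2 * (d : ℝ) ^ (5 / 2 : ℝ)) =
      ((d : ℝ) ^ 2 - 1) / (2 * d ^ 2) / (Real.sqrt d * Real.sqrt (d + 1)) := by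
    rw [hr, ← Real.sqrt_eq_rpow]
    field_simp
    linear_combination ((d : ℝ) - 1) * hqq
  have hu' : (1 - unitarity E) * (((d : ℝ) ^ 2 - 1) / (2 * d ^ 2)) ≤ 1 - p l₀ := by
    rw [← mul_div_assoc, div_le_iff₀ (by positivity)]
    linarith
  rw [hΔ, hC]
  calc K * genNorm J * (1 - unitarity E) *
        (((d : ℝ) ^ 2 - 1) / (2 * d ^ 2) / (Real.sqrt d * Real.sqrt (d + 1)))
      = K * ((1 - unitarity E) * (((d : ℝ) ^ 2 - 1) / (2 * d ^ 2))) *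
        (genNorm J / (Real.sqrt d * Real.sqrt (d + 1))) := by ring
    _ ≤ K * (1 - p l₀) * (genNorm J / (Real.sqrt d * Real.sqrt (d + 1))) := by gcongr
    _ ≤ (1 - F) * (genNorm J / (Real.sqrt d * Real.sqrt (d + 1))) := by gcongr

end IsMultiplicityFreeDecomposition

end Main

end CovariantChannel

theorem mainTheorem5 {m : ℕ} {G : Type*} [Group G] [TopologicalSpace G]
    [ChartedSpace (EuclideanSpace ℝ (Fin m)) G] [LieGroup (𝓡 m) ∞ G]
    [T2Space G] [CompactSpace G] [ConnectedSpace G]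
    {d n : ℕ} (hd : 2 ≤ d)
    (U : G →* Matrix.unitaryGroup (Fin d) ℂ)
    (hU : ∀ i j : Fin d,
      ContMDiff (𝓡 m) 𝓘(ℝ, ℂ) ∞ (fun g : G => (U g : CovariantChannel.Op d) i j))
    (x : Fin n → GroupLieAlgebra (𝓡 m) G) (J : Fin n → CovariantChannel.Op d)
    (hJ : CovariantChannel.IsGeneratingFamily U x J)
    (hJtr : ∀ k, (J k).trace = 0)
    {ι : Type*} [Fintype ι] [DecidableEq ι]
    (V : ι → Subrepresentation (CovariantChannel.conjRep U))
    (hV : CovariantChannel.IsMultiplicityFreeDecomposition U V) :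
    (∀ f : ι → ℝ,
      (∀ l k, CovariantChannel.adjoint
        (CovariantChannel.blockChannel (V l).toSubmodule) (J k) = (f l : ℂ) • J k) →
      ∀ E : CovariantChannel.SuperOp d,
        CovariantChannel.IsChannel E → CovariantChannel.IsCovariant U E →
        Real.sqrt (CovariantChannel.avgDeviation J E) ≥
          CovariantChannel.minGap U V f * CovariantChannel.genNorm J *
            (1 - CovariantChannel.unitarity E) *
            (((d : ℝ) - 1) * ((d : ℝ) + 1) ^ (1 / 2 : ℝ) / (2 * (d : ℝ) ^ (5 / 2 : ℝ)))) ∧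
    ((∃ l, ∀ k, J k ∈ V l) →
      ∃ f : ι → ℝ, ∀ l k, CovariantChannel.adjoint
        (CovariantChannel.blockChannel (V l).toSubmodule) (J k) = (f l : ℂ) • J k) := by
  have hd' : d ≠ 0 := by omega
  exact ⟨fun f hf E hE hcov => hV.sqrt_avgDeviation_ge hd hJ.isHermitian hJtr hf hE hcov,
    fun ⟨_, hm⟩ => hV.exists_eigenvalues hd' hJ.isHermitian hm⟩
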